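/- For a smooth Riemannian manifold $(M^n,g)$ without boundary, let $B(x,r)$ be the open geodesic ball, let $\mathrm{Rm}$ be the Riemann curvature tensor, $\nabla$ the Levi-Civita connection, $|\cdot|$ the pointwise tensor norm induced by $g$, and let volumes and integrals be taken with respect to the Riemannian measure. For $\Lambda>0$ and an integer $k\ge 1$, the metric $g$ is called $(\Lambda,k)$ regular if for all $x\in M$, $r>0$ and $\varepsilon\in(0,1)$ such that $$\sup_{B(x,\varepsilon r)}|\mathrm{Rm}|\le \frac1{r^2},$$ one has $$\sup_{B(x,\frac{\varepsilon}{2} r)}|\nabla^j\mathrm{Rm}|\le\frac{\Lambda}{(\varepsilon r)^j r^2}\qquad\text{for all } j=1,\dots,k.$$ **Theorem.** For every integer $n\ge 1$ and every real $\Lambda\ge 1$ there is a constant $\epsilon(\Lambda,n)>0$ such that the following holds. Let $(M^n,g)$ be a complete Riemannian manifold whose metric is $(\Lambda,1)$ regular. If for some $x\in M$, $r>0$ and $v>0$ we have i) $\operatorname{vol}B(y,s)\ge v\,s^n$ for all $y\in B(x,\tfrac34 r)$ and all $s\in(0,\tfrac r4)$, and ii) $\displaystyle\int_{B(x,r)}|\mathrm{Rm}|^{n/2}\,d\mathrm{vol}_g\le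 \epsilon(\Lambda,n)\,v$, then $$\sup_{B(x,\frac12 r)}|\mathrm{Rm}|\le\frac{16}{r^2}\left(\frac1{v\,\epsilon(\Lambda,n)}\int_{B(x,r)}|\mathrm{Rm}|^{n/2}\,d\mathrm{vol}_g\right)^{2/n}.$$ -/

import Mathlib

open Bundle
open scoped Manifold ContDiff

/-! ### Tensor calculus in local coordinates

Throughout, `G : EuclideanSpace ℝ (Fin n) → Matrix (Fin n) (Fin n) ℝ` is the matrix `(g_ij)` of a
Riemannian metric in a coordinate system, as a function of the coordinates.
A covariant `k`-tensor field is given by its components `T u (i₁, …, i_k)`. -/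

noncomputable section

namespace LocalCoord

variable {n : ℕ}

/-- Covariant `k`-tensor fields in coordinates. -/
abbrev TensorField (n k : ℕ) : Type :=
  EuclideanSpace ℝ (Fin n) → (Fin k → Fin n) → ℝ

/-- The partial derivative `∂_i f`. -/
def partialDeriv (i : Fin n) (f : EuclideanSpace ℝ (Fin n) → ℝ) (u : EuclideanSpace ℝ (Fin n)) :
    ℝ :=
  fderiv ℝ f u (EuclideanSpace.single i 1)

/-- The Christoffel symbol of the Levi-Civita connection,
`Γ^k_ij = ½ ∑_l g^{kl} (∂_i g_jl + ∂_j g_il - ∂_l g_ij)`. -/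
def christoffel (G : EuclideanSpace ℝ (Fin n) → Matrix (Fin n) (Fin n) ℝ) (k i j : Fin n)
    (u : EuclideanSpace ℝ (Fin n)) : ℝ :=
  (1 / 2) * ∑ l, (G u)⁻¹ k l *
    (partialDeriv i (fun w => G w j l) u + partialDeriv j (fun w => G w i l) u
      - partialDeriv l (fun w => G w i j) u)

/-- The component along `∂_m` of `R(∂_i, ∂_j) ∂_k = ∇_i ∇_j ∂_k - ∇_j ∇_i ∂_k`. -/
def curvatureEndo (G : EuclideanSpace ℝ (Fin n) → Matrix (Fin n) (Fin n) ℝ) (i j k m : Fin n)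
    (u : EuclideanSpace ℝ (Fin n)) : ℝ :=
  partialDeriv i (christoffel G m j k) u - partialDeriv j (christoffel G m i k) u
    + ∑ p, (christoffel G m i p u * christoffel G p j k u
      - christoffel G m j p u * christoffel G p i k u)

/-- The Riemann curvature tensor as a covariant 4-tensor,
`R_ijkl = g(R(∂_i, ∂_j) ∂_k, ∂_l)`. -/
def riemann (G : EuclideanSpace ℝ (Fin n) → Matrix (Fin n) (Fin n) ℝ) : TensorField n 4 :=
  fun u i => ∑ m, G u m (i 3) * curvatureEndo G (i 0) (i 1) (i 2) m u

/-- The covariant derivative of a covariant `k`-tensor field; the first index of the result is the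
direction of differentiation:
`∇_m T_{i₁ … i_k} = ∂_m T_{i₁ … i_k} - ∑_a ∑_p Γ^p_{m i_a} T_{i₁ … p … i_k}`,
with `p` in position `a`. -/
def covDeriv (G : EuclideanSpace ℝ (Fin n) → Matrix (Fin n) (Fin n) ℝ) {k : ℕ}
    (T : TensorField n k) : TensorField n (k + 1) :=
  fun u i => partialDeriv (i 0) (fun w => T w (Fin.tail i)) u
    - ∑ a : Fin k, ∑ p : Fin n,
        christoffel G p (i 0) (Fin.tail i a) u * T u (Function.update (Fin.tail i) a p)

/-- The iterated covariant derivative `∇^j Rm`, a covariant `(4 + j)`-tensor field. -/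
def iterCovDerivRiemann (G : EuclideanSpace ℝ (Fin n) → Matrix (Fin n) (Fin n) ℝ) :
    (j : ℕ) → TensorField n (4 + j)
  | 0 => riemann G
  | j + 1 => covDeriv G (iterCovDerivRiemann G j)

/-- The pointwise norm of a covariant `k`-tensor `t` with respect to the inner product with matrix
`A = (g_ij)`: `|t|² = ∑ g^{i₁ j₁} ⋯ g^{i_k j_k} t_{i₁ … i_k} t_{j₁ … j_k}`. -/
def tensorNorm (A : Matrix (Fin n) (Fin n) ℝ) {k : ℕ} (t : (Fin k → Fin n) → ℝ) : ℝ :=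
  Real.sqrt (∑ i : Fin k → Fin n, ∑ j : Fin k → Fin n, (∏ a, A⁻¹ (i a) (j a)) * t i * t j)

end LocalCoord

/-! ### Riemannian manifolds

`M` is a smooth `n`-manifold without boundary, whose tangent spaces carry inner products. -/

namespace RiemannianGeometry

variable {n : ℕ} {M : Type*} [EMetricSpace M] [ChartedSpace (EuclideanSpace ℝ (Fin n)) M]
  [RiemannianBundle (fun x : M => TangentSpace (𝓡 n) x)]

/-- The coordinate vector field `∂_i` of the preferred chart at `c`, at the point with
coordinates `u`. -/
def coordVector (c : M) (i : Fin n) (u : EuclideanSpace ℝ (Fin n)) :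
    TangentSpace (𝓡 n) ((extChartAt (𝓡 n) c).symm u) :=
  mfderiv (𝓡 n) (𝓡 n) (extChartAt (𝓡 n) c).symm u
    (EuclideanSpace.single i (1 : ℝ) : EuclideanSpace ℝ (Fin n))

/-- The matrix `g_ij = g(∂_i, ∂_j)` of the metric in the preferred chart at `c`. -/
def metricMatrix (c : M) (u : EuclideanSpace ℝ (Fin n)) : Matrix (Fin n) (Fin n) ℝ :=
  Matrix.of fun i j => inner ℝ (coordVector c i u) (coordVector c j u)

variable (n) in
/-- The function `|∇^j Rm|` on `M`, computed at `x` in the preferred chart at `x`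
(the value does not depend on the chart). -/
def normIterCovDerivRm (j : ℕ) (x : M) : ℝ :=
  LocalCoord.tensorNorm (metricMatrix x (extChartAt (𝓡 n) x x))
    (LocalCoord.iterCovDerivRiemann (metricMatrix x) j (extChartAt (𝓡 n) x x))

variable (n) in
/-- The function `|Rm|` on `M`. -/
def normRm (x : M) : ℝ := normIterCovDerivRm n 0 x

variable (n) in
/-- The metric of `M` is `(Λ, k)` regular: whenever `0 < ε < 1`, `r > 0` and
`|Rm| ≤ r⁻²` on `B(x, ε r)`, one has `|∇^j Rm| ≤ Λ (ε r)^{-j} r⁻²` on `B(x, ε r / 2)` for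
`j = 1, …, k`. -/
def IsRegular (M : Type*) [EMetricSpace M] [ChartedSpace (EuclideanSpace ℝ (Fin n)) M]
    [RiemannianBundle (fun x : M => TangentSpace (𝓡 n) x)] (Λ : ℝ) (k : ℕ) : Prop :=
  ∀ (x : M) (r ε : ℝ), 0 < r → 0 < ε → ε < 1 →
    (∀ y ∈ Metric.eball x (ENNReal.ofReal (ε * r)), normRm n y ≤ 1 / r ^ 2) →
    ∀ j : ℕ, 1 ≤ j → j ≤ k →
      ∀ y ∈ Metric.eball x (ENNReal.ofReal (ε / 2 * r)),
        normIterCovDerivRm n j y ≤ Λ / ((ε * r) ^ j * r ^ 2)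

variable [MeasurableSpace M]

/-- The Riemannian measure of the domain of the preferred chart at `c` (extended by zero):
the push-forward of `√(det g_ij) du` under the inverse of the chart. -/
def chartVolume (c : M) : MeasureTheory.Measure M :=
  ((MeasureTheory.volume.restrict (extChartAt (𝓡 n) c).target).withDensity
    fun u : EuclideanSpace ℝ (Fin n) => ENNReal.ofReal (Real.sqrt (metricMatrix c u).det)).map
    (extChartAt (𝓡 n) c).symm

variable (n M) in
/-- The Riemannian measure of `M`. The measures `chartVolume c` agree on overlaps of chart
domains, so the least measure above all of them is the measure on `M` which restricts to
`chartVolume c` on the domain of each chart. -/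
def riemannianVolume : MeasureTheory.Measure M := ⨆ c : M, chartVolume (n := n) c

end RiemannianGeometry

end

/-! Suppose the bound fails at `z`. Let `δ₀ ^ n` be the curvature integral divided by `v ε`, so that
the bound at `z` reads `|Rm|(z) ≤ 16 δ₀² / r²`, and take `δ > δ₀` for which `|Rm|(z) ≤ 16 δ² / r²`
still fails. Point picking (`exists_edist_lt_forall_le_four_mul`) moves `z` by less than `r / 4` to
a point `y₀` where `|Rm|` is at least as large and, with `q = |Rm|(y₀)^(1/2)`, satisfies `|Rm| ≤ 4
q²` on the ball of radius `δ / (2 q)`. Regularity turns this into a bound on `|∇Rm|`, which keeps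
`|Rm| ≥ q² / 2` on the ball of radius `s = δ / (32 Λ q)` (`IsRegular.le_normRm`). By i) that ball
has volume at least `v s ^ n`, so the integral is at least `(q / 2) ^ n v s ^ n`. By scale
invariance `q` cancels and `v ε δ ^ n` is left, which exceeds the integral `v ε δ₀ ^ n`. The volume
enters only through i).

The geometric input is that `|Rm|` is continuous and changes along a curve at rate at most `|∇Rm|`
times the speed. The latter is the Kato inequality (`abs_fderiv_tensorInner_le`): metric
compatibility gives `d|T|² (X) = 2 ⟨∇T, X♭ ⊗ T⟩`, and Cauchy–Schwarz does the rest.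

Since `|Rm|` is evaluated at each point in that point's own chart, differentiating it in a fixed
chart requires the Riemann tensor to be tensorial (`IsPullback.riemann_eq_pullTensor`). The analogue
for `∇Rm` is not needed: the derivative at time `t` is computed in the chart at the curve's position
at time `t`, the one in which `|∇Rm|` is evaluated there. -/

namespace LocalCoord

variable {n : ℕ}

/-! ### Kronecker powers and the inner product of tensors -/

/-- The `k`-th Kronecker power of a matrix. -/
def kronPow {p : ℕ} (k : ℕ) (A : Matrix (Fin p) (Fin p) ℝ) :
    Matrix (Fin k → Fin p) (Fin k → Fin p) ℝ :=
  Matrix.of fun i j => ∏ a, A (i a) (j a)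

theorem kronPow_apply {k : ℕ} (A : Matrix (Fin n) (Fin n) ℝ) (i j : Fin k → Fin n) :
    kronPow k A i j = ∏ a, A (i a) (j a) := rfl

theorem kronPow_mul {k : ℕ} (A B : Matrix (Fin n) (Fin n) ℝ) :
    kronPow k (A * B) = kronPow k A * kronPow k B := by
  ext i j
  simp only [kronPow_apply, Matrix.mul_apply, Finset.prod_univ_sum, Fintype.piFinset_univ,
    Finset.prod_mul_distrib]

theorem kronPow_transpose {k : ℕ} (A : Matrix (Fin n) (Fin n) ℝ) :
    kronPow k A.transpose = (kronPow k A).transpose := rfl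

/-- The inner product of covariant tensors with respect to the inner product with matrix `A`. -/
noncomputable def tensorInner (A : Matrix (Fin n) (Fin n) ℝ) {k : ℕ} (s t : (Fin k → Fin n) → ℝ) :
    ℝ :=
  s ⬝ᵥ (kronPow k A⁻¹).mulVec t

theorem tensorInner_eq_sum (A : Matrix (Fin n) (Fin n) ℝ) {k : ℕ} (s t : (Fin k → Fin n) → ℝ) :
    tensorInner A s t = ∑ i, ∑ j, (∏ a, A⁻¹ (i a) (j a)) * s i * t j := by
  simp only [tensorInner, dotProduct, Matrix.mulVec, kronPow_apply, Finset.mul_sum]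
  exact Finset.sum_congr rfl fun i _ => Finset.sum_congr rfl fun j _ => by ring

theorem tensorNorm_eq_sqrt (A : Matrix (Fin n) (Fin n) ℝ) {k : ℕ} (t : (Fin k → Fin n) → ℝ) :
    tensorNorm A t = Real.sqrt (tensorInner A t t) := by
  rw [tensorInner_eq_sum]; rfl

/-- The pull-back of a covariant tensor under the linear map with matrix `J`. -/
def pullTensor (J : Matrix (Fin n) (Fin n) ℝ) {k : ℕ} (t : (Fin k → Fin n) → ℝ) :
    (Fin k → Fin n) → ℝ :=
  (kronPow k J).transpose.mulVec t

/-- Invariance under change of basis comes down to `J (Jᵀ A J)⁻¹ Jᵀ = A⁻¹`, which passes to tensors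
because Kronecker powers are multiplicative. -/
theorem tensorInner_pullTensor {A J : Matrix (Fin n) (Fin n) ℝ} (hJ : IsUnit J.det) {k : ℕ}
    (s t : (Fin k → Fin n) → ℝ) :
    tensorInner (J.transpose * A * J) (pullTensor J s) (pullTensor J t) = tensorInner A s t := by
  have hJt : IsUnit J.transpose.det := by rwa [Matrix.det_transpose]
  have key : J * (J.transpose * A * J)⁻¹ * J.transpose = A⁻¹ := by
    rw [Matrix.mul_inv_rev, Matrix.mul_inv_rev, Matrix.mul_nonsing_inv_cancel_left _ _ hJ,
      Matrix.mul_assoc, Matrix.nonsing_inv_mul _ hJt, Matrix.mul_one]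
  rw [tensorInner, tensorInner, pullTensor, pullTensor, ← key, kronPow_mul, kronPow_mul,
    kronPow_transpose, Matrix.mulVec_transpose, ← Matrix.dotProduct_mulVec, Matrix.mulVec_mulVec,
    Matrix.mulVec_mulVec, Matrix.mul_assoc]

theorem tensorNorm_pullTensor {A J : Matrix (Fin n) (Fin n) ℝ} (hJ : IsUnit J.det) {k : ℕ}
    (t : (Fin k → Fin n) → ℝ) :
    tensorNorm (J.transpose * A * J) (pullTensor J t) = tensorNorm A t := by
  rw [tensorNorm_eq_sqrt, tensorNorm_eq_sqrt, tensorInner_pullTensor hJ]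

/-- Factor `A⁻¹ = Bᵀ B`; the Kronecker power of `B` serves as `P`. Positivity and Cauchy–Schwarz for
tensors thereby reduce to the standard dot product. -/
theorem exists_tensorInner_eq_dotProduct {A : Matrix (Fin n) (Fin n) ℝ} (hA : A.PosDef) (k : ℕ) :
    ∃ P : Matrix (Fin k → Fin n) (Fin k → Fin n) ℝ, ∀ s t : (Fin k → Fin n) → ℝ,
      tensorInner A s t = P.mulVec s ⬝ᵥ P.mulVec t := by
  obtain ⟨B, hB⟩ : ∃ B : Matrix (Fin n) (Fin n) ℝ, A⁻¹ = B.transpose * B := by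
    have h := hA.inv.posSemidef
    open scoped MatrixOrder in
    obtain ⟨B, hB⟩ := CStarAlgebra.nonneg_iff_eq_star_mul_self.mp h.nonneg
    exact ⟨B, by
      simpa only
          [Matrix.star_eq_conjTranspose, Matrix.conjTranspose_eq_transpose_of_trivial] using hB⟩
  refine ⟨kronPow k B, fun s t => ?_⟩
  rw [tensorInner, hB, kronPow_mul, kronPow_transpose, ← Matrix.mulVec_mulVec,
    Matrix.dotProduct_mulVec, Matrix.vecMul_transpose]

theorem tensorInner_self_nonneg {A : Matrix (Fin n) (Fin n) ℝ} (hA : A.PosDef) {k : ℕ}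
    (t : (Fin k → Fin n) → ℝ) : 0 ≤ tensorInner A t t := by
  obtain ⟨P, hP⟩ := exists_tensorInner_eq_dotProduct hA k
  rw [hP, dotProduct]
  exact Finset.sum_nonneg fun i _ => mul_self_nonneg _

theorem abs_tensorInner_le {A : Matrix (Fin n) (Fin n) ℝ} (hA : A.PosDef) {k : ℕ}
    (s t : (Fin k → Fin n) → ℝ) : |tensorInner A s t| ≤ tensorNorm A s * tensorNorm A t := by
  rw [tensorNorm_eq_sqrt, tensorNorm_eq_sqrt, ← Real.sqrt_mul (tensorInner_self_nonneg hA s)]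
  apply Real.abs_le_sqrt
  obtain ⟨P, hP⟩ := exists_tensorInner_eq_dotProduct hA k
  simp only [hP, dotProduct, ← pow_two]
  exact Finset.sum_mul_sq_le_sq_mul_sq _ _ _

theorem sum_fin_succ_arrow {α : Type*} [Fintype α] {k : ℕ} (g : (Fin (k + 1) → α) → ℝ) :
    ∑ f, g f = ∑ a, ∑ f : Fin k → α, g (Fin.cons a f) := by
  rw [← Fintype.sum_prod_type' (f := fun a f => g (Fin.cons a f))]
  exact (Fintype.sum_equiv (Fin.consEquiv fun _ => α) _ _ fun _ => rfl).symm

/-! ### Partial derivatives -/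

theorem ContDiffAt.partialDeriv {f : EuclideanSpace ℝ (Fin n) → ℝ} {u : EuclideanSpace ℝ (Fin n)}
    (hf : ContDiffAt ℝ ∞ f u) (i : Fin n) :
    ContDiffAt ℝ ∞ (partialDeriv i f) u :=
  (hf.fderiv_right (m := ∞) (by simp)).clm_apply contDiffAt_const

theorem partialDeriv_congr {f g : EuclideanSpace ℝ (Fin n) → ℝ} {u : EuclideanSpace ℝ (Fin n)}
    (h : f =ᶠ[nhds u] g) (i : Fin n) :
    partialDeriv i f u = partialDeriv i g u := by
  rw [partialDeriv, partialDeriv, h.fderiv_eq]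

theorem partialDeriv_sub {f g : EuclideanSpace ℝ (Fin n) → ℝ} {u : EuclideanSpace ℝ (Fin n)}
    (hf : DifferentiableAt ℝ f u)
    (hg : DifferentiableAt ℝ g u) (i : Fin n) :
    partialDeriv i (fun w => f w - g w) u = partialDeriv i f u - partialDeriv i g u := by
  simp [partialDeriv, fderiv_fun_sub hf hg]

theorem partialDeriv_mul {f g : EuclideanSpace ℝ (Fin n) → ℝ} {u : EuclideanSpace ℝ (Fin n)}
    (hf : DifferentiableAt ℝ f u)
    (hg : DifferentiableAt ℝ g u) (i : Fin n) :
    partialDeriv i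
        (fun w => f w * g w) u = partialDeriv i f u * g u + f u * partialDeriv i g u := by
  simp [partialDeriv, fderiv_fun_mul hf hg]; ring

theorem partialDeriv_sum {ι : Type*} (s : Finset ι) {f : ι → EuclideanSpace ℝ (Fin n) → ℝ}
    {u : EuclideanSpace ℝ (Fin n)}
    (hf : ∀ a ∈ s, DifferentiableAt ℝ (f a) u) (i : Fin n) :
    partialDeriv i (fun w => ∑ a ∈ s, f a w) u = ∑ a ∈ s, partialDeriv i (f a) u := by
  simp [partialDeriv, fderiv_fun_sum hf]

theorem fderiv_eq_sum_partialDeriv (f : EuclideanSpace ℝ (Fin n) → ℝ)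
    (u X : EuclideanSpace ℝ (Fin n)) :
    fderiv ℝ f u X = ∑ i, X i * partialDeriv i f u := by
  have hX : X = ∑ i, X i • EuclideanSpace.single i (1 : ℝ) := by
    ext j; simp [Pi.single_apply]
  conv_lhs => rw [hX]
  simp [partialDeriv, map_sum]

theorem partialDeriv_comp {f : EuclideanSpace ℝ (Fin n) → ℝ}
    {φ : EuclideanSpace ℝ (Fin n) → EuclideanSpace ℝ (Fin n)} {u : EuclideanSpace ℝ (Fin n)}
    (hf : DifferentiableAt ℝ f (φ u))
    (hφ : DifferentiableAt ℝ φ u) (i : Fin n) :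
    partialDeriv i (fun w => f (φ w)) u
      = ∑ b, partialDeriv i (fun w => φ w b) u * partialDeriv b f (φ u) := by
  have h1 : partialDeriv i (fun w => f (φ w)) u
      = fderiv ℝ f (φ u) (fderiv ℝ φ u (EuclideanSpace.single i 1)) := by
    rw [partialDeriv, show (fun w => f (φ w)) = f ∘ φ from rfl, fderiv_comp u hf hφ]; rfl
  rw [h1, fderiv_eq_sum_partialDeriv]
  refine Finset.sum_congr rfl fun b _ => ?_
  congr 1
  have : HasFDerivAt (fun w => φ w b)
      ((EuclideanSpace.proj b : EuclideanSpace ℝ (Fin n) →L[ℝ] ℝ).comp (fderiv ℝ φ u)) u :=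
    (EuclideanSpace.proj b : EuclideanSpace ℝ (Fin n) →L[ℝ] ℝ).hasFDerivAt.comp u hφ.hasFDerivAt
  rw [partialDeriv, this.fderiv]; rfl

theorem partialDeriv_comm {f : EuclideanSpace ℝ (Fin n) → ℝ} {u : EuclideanSpace ℝ (Fin n)}
    (hf : ContDiffAt ℝ ∞ f u) (i j : Fin n) :
    partialDeriv i (partialDeriv j f) u = partialDeriv j (partialDeriv i f) u := by
  have hd : DifferentiableAt ℝ (fderiv ℝ f) u :=
    (hf.fderiv_right (m := ∞) (by simp)).differentiableAt (by simp)
  have h : ∀ a b : Fin n, partialDeriv a (partialDeriv b f) u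
      = fderiv ℝ (fderiv ℝ f) u (EuclideanSpace.single a 1) (EuclideanSpace.single b 1) := by
    intro a b
    have := hd.hasFDerivAt.clm_apply (hasFDerivAt_const (EuclideanSpace.single b (1 : ℝ)) u)
    rw [partialDeriv, show partialDeriv b f = fun w => fderiv ℝ f w (EuclideanSpace.single b 1)
      from rfl, this.fderiv]
    simp
  rw [h, h]
  exact (hf.isSymmSndFDerivAt (by simpa using WithTop.coe_le_coe.2 (le_top : (2 : ℕ∞) ≤ ⊤))).eq _ _

/-! ### Calculus of matrix-valued functions -/

/-- The entrywise partial derivative of a matrix-valued function. -/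
noncomputable def matDeriv {p q : Type*} (i : Fin n) (F : EuclideanSpace ℝ (Fin n) → Matrix p q ℝ)
    (u : EuclideanSpace ℝ (Fin n)) : Matrix p q ℝ :=
  Matrix.of fun a b => partialDeriv i (fun w => F w a b) u

/-- The entries of a matrix-valued function are smooth at a point. -/
def SmoothAt {p q : Type*} (F : EuclideanSpace ℝ (Fin n) → Matrix p q ℝ)
    (u : EuclideanSpace ℝ (Fin n)) : Prop :=
  ∀ a b, ContDiffAt ℝ ∞ (fun w => F w a b) u

namespace SmoothAt

variable {p q r : Type*} {F : EuclideanSpace ℝ (Fin n) → Matrix p q ℝ}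
    {H : EuclideanSpace ℝ (Fin n) → Matrix q r ℝ} {u : EuclideanSpace ℝ (Fin n)}

theorem differentiableAt {F : EuclideanSpace ℝ (Fin n) → Matrix p q ℝ} (h : SmoothAt F u) (a : p)
    (b : q) :
    DifferentiableAt ℝ (fun w => F w a b) u :=
  (h a b).differentiableAt (by simp)

theorem mul [Fintype q] (hF : SmoothAt F u) (hH : SmoothAt H u) : SmoothAt
    (fun w => F w * H w) u := by
  intro a b
  simp only [Matrix.mul_apply]
  exact ContDiffAt.sum fun c _ => (hF a c).mul (hH c b)

theorem add {F H : EuclideanSpace ℝ (Fin n) → Matrix p q ℝ} (hF : SmoothAt F u)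
    (hH : SmoothAt H u) : SmoothAt (fun w => F w + H w) u :=
  fun a b => (hF a b).add (hH a b)

theorem sub {F H : EuclideanSpace ℝ (Fin n) → Matrix p q ℝ} (hF : SmoothAt F u)
    (hH : SmoothAt H u) :
    SmoothAt (fun w => F w - H w) u :=
  fun a b => (hF a b).sub (hH a b)

theorem transpose (hF : SmoothAt F u) : SmoothAt (fun w => (F w).transpose) u :=
  fun a b => hF b a

theorem matDeriv (hF : SmoothAt F u) (i : Fin n) : SmoothAt (matDeriv i F) u :=
  fun a b => LocalCoord.ContDiffAt.partialDeriv (hF a b) i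

theorem det [Fintype q] [DecidableEq q] {F : EuclideanSpace ℝ (Fin n) → Matrix q q ℝ}
    (hF : SmoothAt F u) :
    ContDiffAt ℝ ∞ (fun w => (F w).det) u := by
  simp only [Matrix.det_apply]
  exact ContDiffAt.sum fun σ _ => ContDiffAt.const_smul _ (contDiffAt_prod fun c _ => hF _ _)

/-- Cramer's rule: the entries of the inverse are cofactors, polynomial in the entries of `F`,
divided by a determinant that does not vanish at `u`. -/
theorem inv [Fintype q] [DecidableEq q] {F : EuclideanSpace ℝ (Fin n) → Matrix q q ℝ}
    (hF : SmoothAt F u) (hu : IsUnit (F u).det) :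
    SmoothAt (fun w => (F w)⁻¹) u := by
  intro a b
  simp only [Matrix.inv_def, Matrix.smul_apply, smul_eq_mul, Ring.inverse_eq_inv',
    Matrix.adjugate_apply]
  refine (hF.det.inv hu.ne_zero).mul (det fun c d => ?_)
  by_cases h : c = b
  · subst h; simp only [Matrix.updateRow_self]; exact contDiffAt_const
  · simp only [Matrix.updateRow_ne h]; exact hF c d

end SmoothAt

section

variable {p q r : Type*} {F : EuclideanSpace ℝ (Fin n) → Matrix p q ℝ}
    {H : EuclideanSpace ℝ (Fin n) → Matrix q r ℝ} {u : EuclideanSpace ℝ (Fin n)}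

theorem matDeriv_mul [Fintype q] (hF : SmoothAt F u) (hH : SmoothAt H u) (i : Fin n) :
    matDeriv i (fun w => F w * H w) u = matDeriv i F u * H u + F u * matDeriv i H u := by
  ext a b
  simp only [matDeriv, Matrix.of_apply, Matrix.add_apply, Matrix.mul_apply]
  rw [partialDeriv_sum _ fun c _ => (hF.differentiableAt a c).fun_mul (hH.differentiableAt c b),
    ← Finset.sum_add_distrib]
  exact Finset.sum_congr rfl fun c _ =>
    partialDeriv_mul (hF.differentiableAt a c) (hH.differentiableAt c b) i

theorem matDeriv_sub {F H : EuclideanSpace ℝ (Fin n) → Matrix p q ℝ} (hF : SmoothAt F u)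
    (hH : SmoothAt H u)
    (i : Fin n) : matDeriv i (fun w => F w - H w) u = matDeriv i F u - matDeriv i H u := by
  ext a b
  exact partialDeriv_sub (hF.differentiableAt a b) (hH.differentiableAt a b) i

theorem matDeriv_congr {F H : EuclideanSpace ℝ (Fin n) → Matrix p q ℝ} (h : F =ᶠ[nhds u] H)
    (i : Fin n) :
    matDeriv i F u = matDeriv i H u := by
  ext a b
  exact partialDeriv_congr (h.mono fun w hw => by simp only [hw]) i

theorem matDeriv_transpose (F : EuclideanSpace ℝ (Fin n) → Matrix p q ℝ) (i : Fin n)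
    (u : EuclideanSpace ℝ (Fin n)) :
    matDeriv i (fun w => (F w).transpose) u = (matDeriv i F u).transpose := rfl

theorem matDeriv_comm {F : EuclideanSpace ℝ (Fin n) → Matrix p q ℝ} (hF : SmoothAt F u)
    (i j : Fin n) :
    matDeriv i (matDeriv j F) u = matDeriv j (matDeriv i F) u := by
  ext a b
  exact partialDeriv_comm (hF a b) i j

theorem SmoothAt.congr {F H : EuclideanSpace ℝ (Fin n) → Matrix p q ℝ} (hF : SmoothAt F u)
    (h : H =ᶠ[nhds u] F) :
    SmoothAt H u :=
  fun a b => (hF a b).congr_of_eventuallyEq (h.mono fun w hw => by simp only [hw])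

end

/-! ### The Levi-Civita connection -/

variable {G : EuclideanSpace ℝ (Fin n) → Matrix (Fin n) (Fin n) ℝ} {u : EuclideanSpace ℝ (Fin n)}

/-- The connection matrix `(Γ_i)^k_j = Γ^k_ij`. -/
noncomputable def connMat (G : EuclideanSpace ℝ (Fin n) → Matrix (Fin n) (Fin n) ℝ) (i : Fin n)
    (u : EuclideanSpace ℝ (Fin n)) :
    Matrix (Fin n) (Fin n) ℝ :=
  Matrix.of fun k j => christoffel G k i j u

theorem connMat_apply (i k j : Fin n) : connMat G i u k j = christoffel G k i j u := rfl

theorem SmoothAt.connMat (hG : SmoothAt G u) (hu : IsUnit (G u).det) (i : Fin n) :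
    SmoothAt (connMat G i) u := by
  intro k j
  refine contDiffAt_const.mul (ContDiffAt.sum fun l _ => (hG.inv hu k l).mul ?_)
  exact ((ContDiffAt.partialDeriv (hG j l) i).add (ContDiffAt.partialDeriv (hG i l) j)).sub
    (ContDiffAt.partialDeriv (hG i j) l)

theorem christoffel_symm (hs : ∀ w, (G w).transpose = G w) (k i j : Fin n) :
    christoffel G k i j u = christoffel G k j i u := by
  have h : (fun w => G w j i) = fun w => G w i j := funext fun w => by
    conv_lhs => rw [← hs w]
    rfl
  simp only [christoffel, h]
  congr 1
  exact Finset.sum_congr rfl fun l _ => by ring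

/-- Lowering the upper index cancels the inverse metric and leaves the Christoffel symbols of the
first kind, for which compatibility and uniqueness are linear identities. -/
theorem mul_connMat_apply (hu : IsUnit (G u).det) (i l j : Fin n) :
    (G u * connMat G i u) l j = (1 / 2) *
      (matDeriv i G u j l + matDeriv j G u i l - matDeriv l G u i j) := by
  have h : connMat G i u = (G u)⁻¹ * Matrix.of fun l j => (1 / 2) *
      (matDeriv i G u j l + matDeriv j G u i l - matDeriv l G u i j) := by
    ext k j
    simp only [connMat_apply, christoffel, Matrix.mul_apply, Finset.mul_sum]
    exact Finset.sum_congr rfl fun l _ => by simp only [matDeriv, Matrix.of_apply]; ring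
  rw [h, Matrix.mul_nonsing_inv_cancel_left _ _ hu]; rfl

theorem matDeriv_symm_apply (hs : ∀ w, (G w).transpose = G w) (i a b : Fin n) :
    matDeriv i G u a b = matDeriv i G u b a := by
  have h : (fun w => G w b a) = fun w => G w a b := funext fun w => by
    conv_lhs => rw [← hs w]
    rfl
  simp only [matDeriv, Matrix.of_apply, h]

/-- The Levi-Civita connection is compatible with the metric. -/
theorem matDeriv_metric (hs : ∀ w, (G w).transpose = G w) (hu : IsUnit (G u).det) (i : Fin n) :
    matDeriv i G u = (connMat G i u).transpose * G u + G u * connMat G i u := by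
  ext j l
  have h : ((connMat G i u).transpose * G u) j l = (G u * connMat G i u) l j := by
    rw [← Matrix.transpose_apply (G u * connMat G i u), Matrix.transpose_mul, hs]
  rw [Matrix.add_apply, h, mul_connMat_apply hu, mul_connMat_apply hu,
    matDeriv_symm_apply hs i l j]
  rw [matDeriv_symm_apply hs l i j, matDeriv_symm_apply hs j i l, matDeriv_symm_apply hs l j i,
    matDeriv_symm_apply hs j l i]
  ring

/-- A torsion-free connection which is compatible with the metric is the Levi-Civita connection. -/
theorem eq_connMat (hu : IsUnit (G u).det) (hs : ∀ w, (G w).transpose = G w)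
    {M : Fin n → Matrix (Fin n) (Fin n) ℝ}
    (hM : ∀ i j k, M i k j = M j k i)
    (hG : ∀ i, matDeriv i G u = (M i).transpose * G u + G u * M i) (i : Fin n) :
    M i = connMat G i u := by
  have h1 : ∀ i j l, matDeriv i G u j l = (G u * M i) l j + (G u * M i) j l := by
    intro i j l
    have h : ((M i).transpose * G u) j l = (G u * M i) l j := by
      rw [← Matrix.transpose_apply (G u * M i), Matrix.transpose_mul, hs]
    rw [hG, Matrix.add_apply, h]
  have h2 : ∀ i j l, (G u * M i) l j = (G u * M j) l i := by
    intro i j l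
    simp only [Matrix.mul_apply, hM i j]
  -- The Koszul formula: in the cyclic combination of derivatives of the metric, the symmetry `h2`
  -- cancels everything except twice `G u * M i`.
  have h3 : G u * M i = G u * connMat G i u := by
    ext l j
    rw [mul_connMat_apply hu, h1, h1, h1, h2 j i l, h2 l i j, h2 l j i]
    ring
  rw [← Matrix.nonsing_inv_mul_cancel_left (G u) (M i) hu, h3,
    Matrix.nonsing_inv_mul_cancel_left _ _ hu]

/-- The curvature matrix `(R_ij)^m_k`. -/
noncomputable def curvMat (G : EuclideanSpace ℝ (Fin n) → Matrix (Fin n) (Fin n) ℝ) (i j : Fin n)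
    (u : EuclideanSpace ℝ (Fin n)) :
    Matrix (Fin n) (Fin n) ℝ :=
  matDeriv i (connMat G j) u - matDeriv j (connMat G i) u
    + (connMat G i u * connMat G j u - connMat G j u * connMat G i u)

theorem riemann_eq (i : Fin 4 → Fin n) :
    riemann G u i = ((G u).transpose * curvMat G (i 0) (i 1) u) (i 3) (i 2) := by
  simp only [riemann, Matrix.mul_apply, Matrix.transpose_apply, curvatureEndo, curvMat,
    Matrix.add_apply, Matrix.sub_apply, matDeriv, Matrix.of_apply, connMat,
    Finset.sum_sub_distrib]

theorem SmoothAt.curvMat (hG : SmoothAt G u) (hu : IsUnit (G u).det) (i j : Fin n) :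
    SmoothAt (curvMat G i j) u := by
  have h := hG.connMat hu
  exact (((h j).matDeriv i).sub ((h i).matDeriv j)).add
    (((h i).mul (h j)).sub ((h j).mul (h i)))

/-! ### Change of coordinates -/

/-- The Jacobian matrix `J_ai = ∂_i φ^a`. -/
noncomputable def jacobian (φ : EuclideanSpace ℝ (Fin n) → EuclideanSpace ℝ (Fin n))
    (w : EuclideanSpace ℝ (Fin n)) : Matrix (Fin n) (Fin n) ℝ :=
  Matrix.of fun a i => partialDeriv i (fun x => φ x a) w

theorem contDiffAt_coord {φ : EuclideanSpace ℝ (Fin n) → EuclideanSpace ℝ (Fin n)}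
    {w : EuclideanSpace ℝ (Fin n)} (hφ : ContDiffAt ℝ ∞ φ w) (a : Fin n) :
    ContDiffAt ℝ ∞ (fun x => φ x a) w :=
  (EuclideanSpace.proj a : EuclideanSpace ℝ (Fin n) →L[ℝ] ℝ).contDiff.contDiffAt.comp w hφ

theorem smoothAt_jacobian {φ : EuclideanSpace ℝ (Fin n) → EuclideanSpace ℝ (Fin n)}
    {w : EuclideanSpace ℝ (Fin n)} (hφ : ContDiffAt ℝ ∞ φ w) :
    SmoothAt (jacobian φ) w :=
  fun a i => ContDiffAt.partialDeriv (contDiffAt_coord hφ a) i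

/-- `G'` is the pull-back of the metric `G` under the local diffeomorphism `φ` of the open
set `V`. -/
structure IsPullback (φ : EuclideanSpace ℝ (Fin n) → EuclideanSpace ℝ (Fin n))
    (G G' : EuclideanSpace ℝ (Fin n) → Matrix (Fin n) (Fin n) ℝ)
    (V : Set (EuclideanSpace ℝ (Fin n))) : Prop where
  isOpen : IsOpen V
  smooth : ∀ w ∈ V, ContDiffAt ℝ ∞ φ w
  isUnit_jacobian : ∀ w ∈ V, IsUnit (jacobian φ w).det
  smooth_metric : ∀ w ∈ V, SmoothAt G (φ w)
  isUnit_metric : ∀ w ∈ V, IsUnit (G (φ w)).det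
  symm : ∀ w, (G w).transpose = G w
  symm' : ∀ w, (G' w).transpose = G' w
  eq : ∀ w ∈ V, G' w = (jacobian φ w).transpose * G (φ w) * jacobian φ w

namespace IsPullback

variable {φ : EuclideanSpace ℝ (Fin n) → EuclideanSpace ℝ (Fin n)}
    {G' : EuclideanSpace ℝ (Fin n) → Matrix (Fin n) (Fin n) ℝ}
    {V : Set (EuclideanSpace ℝ (Fin n))} {w : EuclideanSpace ℝ (Fin n)}

theorem smoothAt_comp (h : IsPullback φ G G' V) (hw : w ∈ V)
    {F : EuclideanSpace ℝ (Fin n) → Matrix (Fin n) (Fin n) ℝ}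
    (hF : SmoothAt F (φ w)) : SmoothAt (fun x => F (φ x)) w :=
  fun a b => (hF a b).comp w (h.smooth w hw)

theorem matDeriv_comp (h : IsPullback φ G G' V) (hw : w ∈ V)
    {F : EuclideanSpace ℝ (Fin n) → Matrix (Fin n) (Fin n) ℝ} (hF : SmoothAt F (φ w)) (i : Fin n) :
    matDeriv i (fun x => F (φ x)) w = ∑ b, jacobian φ w b i • matDeriv b F (φ w) := by
  ext a c
  simp only [Matrix.sum_apply, Matrix.smul_apply, smul_eq_mul]
  exact partialDeriv_comp (hF.differentiableAt a c)
    ((h.smooth w hw).differentiableAt (by simp)) i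

theorem eventuallyEq (h : IsPullback φ G G' V) (hw : w ∈ V) :
    G' =ᶠ[nhds w] fun x => (jacobian φ x).transpose * G (φ x) * jacobian φ x :=
  Filter.eventually_of_mem (h.isOpen.mem_nhds hw) h.eq

theorem smoothAt_metric' (h : IsPullback φ G G' V) (hw : w ∈ V) : SmoothAt G' w := by
  have hJ := smoothAt_jacobian (h.smooth w hw)
  exact ((hJ.transpose.mul (h.smoothAt_comp hw (h.smooth_metric w hw))).mul hJ).congr
    (h.eventuallyEq hw)

theorem isUnit_metric' (h : IsPullback φ G G' V) (hw : w ∈ V) : IsUnit (G' w).det := by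
  rw [h.eq w hw, Matrix.det_mul, Matrix.det_mul, Matrix.det_transpose]
  exact ((h.isUnit_jacobian w hw).mul (h.isUnit_metric w hw)).mul (h.isUnit_jacobian w hw)

/-- The pull-back of the connection form of `G`, as a matrix. -/
noncomputable def pullConn (φ : EuclideanSpace ℝ (Fin n) → EuclideanSpace ℝ (Fin n))
    (G : EuclideanSpace ℝ (Fin n) → Matrix (Fin n) (Fin n) ℝ) (i : Fin n)
    (w : EuclideanSpace ℝ (Fin n)) :
    Matrix (Fin n) (Fin n) ℝ :=
  ∑ b, jacobian φ w b i • connMat G b (φ w)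

theorem matDeriv_jacobian_symm (h : IsPullback φ G G' V) (hw : w ∈ V) (i j a : Fin n) :
    matDeriv i (jacobian φ) w a j = matDeriv j (jacobian φ) w a i :=
  partialDeriv_comm (contDiffAt_coord (h.smooth w hw) a) i j

/-- The transformation law of the Levi-Civita connection. -/
theorem matDeriv_jacobian (h : IsPullback φ G G' V) (hw : w ∈ V) (i : Fin n) :
    matDeriv i (jacobian φ) w
      = jacobian φ w * connMat G' i w - pullConn φ G i w * jacobian φ w := by
  have hJ := h.isUnit_jacobian w hw
  have hJt : IsUnit (jacobian φ w).transpose.det := by rwa [Matrix.det_transpose]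
  have hJs := smoothAt_jacobian (h.smooth w hw)
  have hGs := h.smooth_metric w hw
  have hGc := h.smoothAt_comp hw hGs
  -- `J⁻¹ X i` is the gauge transform by `J` of the pulled-back connection. It is torsion-free,
  -- since second derivatives of `φ` commute and `Γ` is symmetric, and it is compatible with `G'`;
  -- uniqueness of the Levi-Civita connection then identifies it.
  set X : Fin n → Matrix (Fin n) (Fin n) ℝ := fun i =>
    pullConn φ G i w * jacobian φ w + matDeriv i (jacobian φ) w with hX
  have hXs : ∀ i j a, X i a j = X j a i := by
    intro i j a
    simp only [hX, Matrix.add_apply, h.matDeriv_jacobian_symm hw i j a]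
    congr 1
    simp only [pullConn, Matrix.mul_apply, Matrix.sum_apply, Matrix.smul_apply, smul_eq_mul,
      Finset.sum_mul]
    rw [Finset.sum_comm]
    refine Finset.sum_congr rfl fun b _ => Finset.sum_congr rfl fun c _ => ?_
    rw [connMat_apply, connMat_apply, christoffel_symm h.symm]; ring
  have key := eq_connMat (G := G') (u := w) (M := fun i => (jacobian φ w)⁻¹ * X i)
    (h.isUnit_metric' hw) h.symm' (fun i j k => by simp only [Matrix.mul_apply, hXs i j])
    (fun i => by
      have hG : matDeriv i (fun x => G (φ x)) w
          = (pullConn φ G i w).transpose * G (φ w) + G (φ w) * pullConn φ G i w := by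
        rw [h.matDeriv_comp hw hGs]
        simp only [matDeriv_metric h.symm (h.isUnit_metric w hw), pullConn, Matrix.transpose_sum,
          Matrix.transpose_smul, Matrix.sum_mul, Matrix.mul_sum, Matrix.smul_mul, Matrix.mul_smul,
          smul_add, Finset.sum_add_distrib]
      rw [matDeriv_congr (h.eventuallyEq hw), matDeriv_mul (hJs.transpose.mul hGc) hJs,
        matDeriv_mul hJs.transpose hGc, matDeriv_transpose, hG, h.eq w hw, Matrix.transpose_mul,
        Matrix.transpose_nonsing_inv]
      have e1 : (X i).transpose * (jacobian φ w).transpose⁻¹ *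
          ((jacobian φ w).transpose * G (φ w) * jacobian φ w)
          = (X i).transpose * G (φ w) * jacobian φ w := by
        rw [Matrix.mul_assoc, Matrix.mul_assoc (jacobian φ w).transpose,
          Matrix.nonsing_inv_mul_cancel_left _ _ hJt, ← Matrix.mul_assoc]
      have e2 : (jacobian φ w).transpose * G (φ w) * jacobian φ w * ((jacobian φ w)⁻¹ * X i)
          = (jacobian φ w).transpose * G (φ w) * X i := by
        rw [Matrix.mul_assoc _ (jacobian φ w), Matrix.mul_nonsing_inv_cancel_left _ _ hJ]
      rw [e1, e2]
      simp only [hX, Matrix.transpose_add, Matrix.transpose_mul]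
      noncomm_ring) i
  rw [← key, Matrix.mul_nonsing_inv_cancel_left _ _ hJ]
  simp only [hX]
  abel

/-- The transformation law of the curvature. -/
theorem jacobian_mul_curvMat (h : IsPullback φ G G' V) (hw : w ∈ V) (i j : Fin n) :
    jacobian φ w * curvMat G' i j w
      = (∑ d, ∑ b, (jacobian φ w d i * jacobian φ w b j) • curvMat G d b (φ w)) *
        jacobian φ w := by
  have hJs := smoothAt_jacobian (h.smooth w hw)
  have hΓ := fun i => (h.smooth_metric w hw).connMat (h.isUnit_metric w hw) i
  have hΓ' := fun i => (h.smoothAt_metric' hw).connMat (h.isUnit_metric' hw) i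
  have hA : ∀ i, SmoothAt (pullConn φ G i) w := by
    intro i a c
    simp only [pullConn, Matrix.sum_apply, Matrix.smul_apply, smul_eq_mul]
    exact ContDiffAt.sum fun b _ => (hJs b i).mul (h.smoothAt_comp hw (hΓ b) a c)
  have hdA : ∀ i j, matDeriv i (pullConn φ G j) w
      = ∑ b, matDeriv i (jacobian φ) w b j • connMat G b (φ w)
        + ∑ b, ∑ d, (jacobian φ w b j * jacobian φ w d i) • matDeriv d (connMat G b) (φ w) := by
    intro i j
    ext a c
    have h1 : ∀ b, partialDeriv i (fun x => connMat G b (φ x) a c) w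
        = (∑ d, jacobian φ w d i • matDeriv d (connMat G b) (φ w)) a c := fun b => by
      rw [← h.matDeriv_comp hw (hΓ b)]; rfl
    simp only [matDeriv, pullConn, Matrix.of_apply, Matrix.sum_apply, Matrix.smul_apply,
      smul_eq_mul, Matrix.add_apply]
    rw [partialDeriv_sum _ fun b _ =>
      (hJs.differentiableAt b j).fun_mul ((h.smoothAt_comp hw (hΓ b)).differentiableAt a c),
      ← Finset.sum_add_distrib]
    refine Finset.sum_congr rfl fun b _ => ?_
    rw [partialDeriv_mul (hJs.differentiableAt b j)
      ((h.smoothAt_comp hw (hΓ b)).differentiableAt a c), h1]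
    simp only [matDeriv, Matrix.of_apply, Matrix.sum_apply, Matrix.smul_apply, smul_eq_mul,
      Finset.mul_sum, mul_assoc]
  -- The curvature of the pulled-back connection is the pulled-back curvature: the terms with second
  -- derivatives of `φ` are symmetric in `i` and `j` and cancel.
  have hF : matDeriv i (pullConn φ G j) w - matDeriv j (pullConn φ G i) w
      + (pullConn φ G i w * pullConn φ G j w - pullConn φ G j w * pullConn φ G i w)
      = ∑ d, ∑ b, (jacobian φ w d i * jacobian φ w b j) • curvMat G d b (φ w) := by
    rw [hdA, hdA]
    simp only [h.matDeriv_jacobian_symm hw i j]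
    rw [Finset.sum_comm (f := fun b d => (jacobian φ w b j * jacobian φ w d i) •
      matDeriv d (connMat G b) (φ w))]
    simp only [pullConn, Matrix.sum_mul, Matrix.mul_sum, Matrix.smul_mul, Matrix.mul_smul,
      curvMat, smul_add, smul_sub, smul_smul, Finset.sum_add_distrib, Finset.sum_sub_distrib,
      Finset.smul_sum]
    rw [Finset.sum_comm (f := fun b d => (jacobian φ w b j * jacobian φ w d i) •
      (connMat G d (φ w) * connMat G b (φ w)))]
    simp only [mul_comm (jacobian φ w _ j)]
    abel
  have hdd : ∀ i j, matDeriv i (matDeriv j (jacobian φ)) w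
      = matDeriv i (jacobian φ) w * connMat G' j w + jacobian φ w * matDeriv i (connMat G' j) w
        - (matDeriv i (pullConn φ G j) w * jacobian φ w
          + pullConn φ G j w * matDeriv i (jacobian φ) w) := by
    intro i j
    have he : matDeriv j (jacobian φ) =ᶠ[nhds w] fun x =>
        jacobian φ x * connMat G' j x - pullConn φ G j x * jacobian φ x :=
      Filter.eventually_of_mem (h.isOpen.mem_nhds hw) fun x hx => h.matDeriv_jacobian hx j
    rw [matDeriv_congr he, matDeriv_sub (hJs.mul (hΓ' j)) ((hA j).mul hJs),
      matDeriv_mul hJs (hΓ' j), matDeriv_mul (hA j) hJs]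
  -- Integrability of `∂_i J = J Γ'_i - A_i J`, where `A_i` is the pulled-back connection: equating
  -- the mixed second derivatives of `J` and substituting the first-order equation again leaves `J
  -- R'_ij = F_ij J`, with `F` the curvature of `A`.
  have hcomm := matDeriv_comm hJs i j
  rw [hdd, hdd, h.matDeriv_jacobian hw, h.matDeriv_jacobian hw] at hcomm
  rw [← hF, curvMat]
  rw [← sub_eq_zero] at hcomm ⊢
  rw [← hcomm]
  noncomm_ring

/-- The Riemann curvature tensor is a tensor. -/
theorem riemann_eq_pullTensor (h : IsPullback φ G G' V) (hw : w ∈ V) :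
    riemann G' w = pullTensor (jacobian φ w) (riemann G (φ w)) := by
  funext i
  rw [riemann_eq, h.eq w hw]
  have e : ((jacobian φ w).transpose * G (φ w) * jacobian φ w).transpose * curvMat G' (i 0) (i 1) w
      = ∑ d, ∑ b, (jacobian φ w d (i 0) * jacobian φ w b (i 1)) • ((jacobian φ w).transpose *
        ((G (φ w)).transpose * curvMat G d b (φ w)) * jacobian φ w) := by
    rw [Matrix.transpose_mul, Matrix.transpose_mul, Matrix.transpose_transpose, Matrix.mul_assoc,
      Matrix.mul_assoc, h.jacobian_mul_curvMat hw]
    simp only [Matrix.sum_mul, Matrix.mul_sum, Matrix.smul_mul, Matrix.mul_smul, Matrix.mul_assoc]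
  rw [e, pullTensor, Matrix.mulVec, dotProduct]
  simp only [sum_fin_succ_arrow, Matrix.transpose_apply, kronPow_apply, Fin.prod_univ_four,
    riemann_eq, Matrix.sum_apply, Matrix.smul_apply, smul_eq_mul, Finset.univ_unique,
    Finset.sum_singleton]
  refine Finset.sum_congr rfl fun d _ => Finset.sum_congr rfl fun b _ => ?_
  change _ = ∑ c, ∑ e, jacobian φ w d (i 0) * jacobian φ w b (i 1) * jacobian φ w c (i 2) *
    jacobian φ w e (i 3) * ((G (φ w)).transpose * curvMat G d b (φ w)) e c
  generalize (G (φ w)).transpose * curvMat G d b (φ w) = C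
  simp only [Matrix.mul_apply, Finset.mul_sum, Finset.sum_mul, Matrix.transpose_apply]
  exact Finset.sum_congr rfl fun c _ => Finset.sum_congr rfl fun e _ => by ring

theorem tensorNorm_riemann (h : IsPullback φ G G' V) (hw : w ∈ V) :
    tensorNorm (G' w) (riemann G' w) = tensorNorm (G (φ w)) (riemann G (φ w)) := by
  rw [h.riemann_eq_pullTensor hw, h.eq w hw, tensorNorm_pullTensor (h.isUnit_jacobian w hw)]

end IsPullback

end LocalCoord

namespace LocalCoord

variable {n : ℕ}

/-! ### The Kato inequality -/

/-- The action on covariant tensors of an endomorphism of the tangent space, as a derivation. -/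
noncomputable def tensorDerivation (Γ : Matrix (Fin n) (Fin n) ℝ) {k : ℕ}
    (t : (Fin k → Fin n) → ℝ) : (Fin k → Fin n) → ℝ :=
  fun i => ∑ a, ∑ p, Γ p (i a) * t (Function.update i a p)

/-- In each slot `a`, exchanging the index `i a` with the summation index `p` is an involution of
the pairs `(i, p)` that matches the two sums term by term. This adjointness moves Christoffel terms
from the metric onto the tensor. -/
theorem sum_mul_tensorDerivation_transpose (Γ : Matrix (Fin n) (Fin n) ℝ) {k : ℕ}
    (s t : (Fin k → Fin n) → ℝ) :
    ∑ i, s i * tensorDerivation Γ.transpose t i = ∑ i, tensorDerivation Γ s i * t i := by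
  simp only [tensorDerivation, Finset.mul_sum, Finset.sum_mul, Matrix.transpose_apply]
  rw [Finset.sum_comm, Finset.sum_comm (s := Finset.univ (α := Fin k → Fin n))]
  refine Finset.sum_congr rfl fun a _ => ?_
  rw [← Fintype.sum_prod_type' (f := fun (i : Fin k → Fin n) p =>
      s i * (Γ (i a) p * t (Function.update i a p))),
    ← Fintype.sum_prod_type' (f := fun (i : Fin k → Fin n) p =>
      Γ p (i a) * s (Function.update i a p) * t i)]
  have hinv : Function.Involutive fun x : (Fin k → Fin n) × Fin n =>
      (Function.update x.1 a x.2, x.1 a) := fun x => by simp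
  refine Fintype.sum_equiv hinv.toPerm _ _ fun x => ?_
  simp only [Function.Involutive.coe_toPerm, Function.update_self, Function.update_idem,
    Function.update_eq_self]
  ring

variable {G : EuclideanSpace ℝ (Fin n) → Matrix (Fin n) (Fin n) ℝ} {u : EuclideanSpace ℝ (Fin n)}

/-- Differentiate `G G⁻¹ = 1`, which holds near `u` because a nonzero determinant stays nonzero, and
insert metric compatibility. -/
theorem matDeriv_inv_metric (hG : SmoothAt G u) (hs : ∀ w, (G w).transpose = G w)
    (hu : IsUnit (G u).det) (m : Fin n) :
    matDeriv m (fun w => (G w)⁻¹) u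
      = -(connMat G m u * (G u)⁻¹ + (G u)⁻¹ * (connMat G m u).transpose) := by
  have he : (fun w => G w * (G w)⁻¹) =ᶠ[nhds u] fun _ => (1 : Matrix (Fin n) (Fin n) ℝ) := by
    filter_upwards [hG.det.continuousAt.eventually_ne hu.ne_zero] with w hw
    exact Matrix.mul_nonsing_inv _ (isUnit_iff_ne_zero.2 hw)
  have h0 : matDeriv m (fun _ => (1 : Matrix (Fin n) (Fin n) ℝ)) u = 0 := by
    ext a b; simp [matDeriv, partialDeriv]
  have h1 := matDeriv_mul hG (hG.inv hu) m
  rw [matDeriv_congr he, h0, matDeriv_metric hs hu] at h1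
  have h2 : G u * matDeriv m (fun w => (G w)⁻¹) u
      = -((connMat G m u).transpose + G u * connMat G m u * (G u)⁻¹) := by
    rw [eq_neg_iff_add_eq_zero, add_comm, h1, add_mul, Matrix.mul_assoc _ (G u),
      Matrix.mul_nonsing_inv _ hu, Matrix.mul_one]
  rw [← Matrix.nonsing_inv_mul_cancel_left (G u) (matDeriv m (fun w => (G w)⁻¹) u) hu, h2,
    Matrix.mul_neg, Matrix.mul_add, Matrix.mul_assoc (G u),
    Matrix.nonsing_inv_mul_cancel_left _ _ hu, add_comm]

theorem partialDeriv_prod {ι : Type*} [DecidableEq ι] (s : Finset ι)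
    {f : ι → EuclideanSpace ℝ (Fin n) → ℝ} (hf : ∀ a ∈ s, DifferentiableAt ℝ (f a) u) (m : Fin n) :
    partialDeriv m (fun w => ∏ a ∈ s, f a w) u
      = ∑ a ∈ s, (∏ b ∈ s.erase a, f b u) * partialDeriv m (f a) u := by
  have h := HasFDerivAt.finsetProd (u := s) fun a ha => (hf a ha).hasFDerivAt
  rw [partialDeriv, h.fderiv]
  simp [partialDeriv]

theorem differentiableAt_kronPow_inv (hG : SmoothAt G u) (hu : IsUnit (G u).det) {k : ℕ}
    (i j : Fin k → Fin n) : DifferentiableAt ℝ (fun w => kronPow k (G w)⁻¹ i j) u :=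
  have h : ContDiffAt ℝ ∞ (fun w => ∏ a, (G w)⁻¹ (i a) (j a)) u :=
    contDiffAt_prod fun a _ => hG.inv hu (i a) (j a)
  h.differentiableAt (by simp)

/-- By the product rule over the slots, each differentiated factor contributes one connection term
on an index of `i` and one on an index of `j`, the other factors being unaffected. -/
theorem partialDeriv_kronPow_inv (hG : SmoothAt G u) (hs : ∀ w, (G w).transpose = G w)
    (hu : IsUnit (G u).det) {k : ℕ} (i j : Fin k → Fin n) (m : Fin n) :
    partialDeriv m (fun w => kronPow k (G w)⁻¹ i j) u
      = -(tensorDerivation (connMat G m u).transpose (fun i' => kronPow k (G u)⁻¹ i' j) i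
        + tensorDerivation (connMat G m u).transpose (fun j' => kronPow k (G u)⁻¹ i j') j) := by
  have hd : ∀ a b, partialDeriv m (fun w => (G w)⁻¹ a b) u
      = -((connMat G m u * (G u)⁻¹) a b + ((G u)⁻¹ * (connMat G m u).transpose) a b) := by
    intro a b
    have := congrFun (congrFun (matDeriv_inv_metric hG hs hu m) a) b
    simpa [matDeriv] using this
  simp only [kronPow_apply]
  rw [partialDeriv_prod _ fun a _ => (hG.inv hu).differentiableAt _ _]
  simp only [hd, tensorDerivation, ← Finset.sum_add_distrib, ← Finset.sum_neg_distrib]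
  refine Finset.sum_congr rfl fun a _ => ?_
  rw [mul_neg, mul_add, Matrix.mul_apply, Matrix.mul_apply, Finset.sum_neg_distrib,
    Finset.sum_add_distrib, Finset.mul_sum, Finset.mul_sum]
  congr 2
  · refine Finset.sum_congr rfl fun p _ => ?_
    have h : ∏ b ∈ Finset.univ.erase a, (G u)⁻¹ (Function.update i a p b) (j b)
        = ∏ b ∈ Finset.univ.erase a, (G u)⁻¹ (i b) (j b) :=
      Finset.prod_congr rfl fun b hb => by
        rw [Function.update_of_ne (Finset.ne_of_mem_erase hb)]
    rw [← Finset.mul_prod_erase _ _ (Finset.mem_univ a), Function.update_self, h,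
      Matrix.transpose_apply]
    ring
  · refine Finset.sum_congr rfl fun p _ => ?_
    have h : ∏ b ∈ Finset.univ.erase a, (G u)⁻¹ (i b) (Function.update j a p b)
        = ∏ b ∈ Finset.univ.erase a, (G u)⁻¹ (i b) (j b) :=
      Finset.prod_congr rfl fun b hb => by
        rw [Function.update_of_ne (Finset.ne_of_mem_erase hb)]
    rw [← Finset.mul_prod_erase _ _ (Finset.mem_univ a), Function.update_self, h,
      Matrix.transpose_apply]
    ring

theorem covDeriv_cons {k : ℕ} (T : TensorField n k) (m : Fin n) (i : Fin k → Fin n) :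
    covDeriv G T u (Fin.cons m i)
      = partialDeriv m (fun w => T w i) u - tensorDerivation (connMat G m u) (T u) i := by
  simp only [covDeriv, Fin.cons_zero, Fin.tail_cons, tensorDerivation, connMat_apply]

theorem tensorInner_comm {A : Matrix (Fin n) (Fin n) ℝ} (hA : A.transpose = A) {k : ℕ}
    (s t : (Fin k → Fin n) → ℝ) : tensorInner A s t = tensorInner A t s := by
  rw [tensorInner, tensorInner, Matrix.dotProduct_mulVec, dotProduct_comm, ← Matrix.mulVec_transpose,
    ← kronPow_transpose, Matrix.transpose_nonsing_inv, hA]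

theorem tensorInner_eq_sum_kronPow (A : Matrix (Fin n) (Fin n) ℝ) {k : ℕ}
    (s t : (Fin k → Fin n) → ℝ) :
    tensorInner A s t = ∑ i, ∑ j, s i * kronPow k A⁻¹ i j * t j := by
  simp only [tensorInner, dotProduct, Matrix.mulVec, Finset.mul_sum, mul_assoc]

theorem differentiableAt_tensorInner (hG : SmoothAt G u) (hu : IsUnit (G u).det) {k : ℕ}
    {T : TensorField n k} (hT : ∀ i, DifferentiableAt ℝ (fun w => T w i) u) :
    DifferentiableAt ℝ (fun w => tensorInner (G w) (T w) (T w)) u := by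
  simp only [tensorInner_eq_sum_kronPow]
  exact DifferentiableAt.fun_sum fun i _ => DifferentiableAt.fun_sum fun j _ =>
    ((hT i).fun_mul (differentiableAt_kronPow_inv hG hu i j)).fun_mul (hT j)

theorem tensorInner_sub_left (A : Matrix (Fin n) (Fin n) ℝ) {k : ℕ}
    (s s' t : (Fin k → Fin n) → ℝ) :
    tensorInner A (fun i => s i - s' i) t = tensorInner A s t - tensorInner A s' t := by
  rw [tensorInner, show (fun i => s i - s' i) = s - s' from rfl, sub_dotProduct]; rfl

/-- The Levi-Civita connection is compatible with the inner product of tensors. -/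
theorem partialDeriv_tensorInner (hG : SmoothAt G u) (hs : ∀ w, (G w).transpose = G w)
    (hu : IsUnit (G u).det) {k : ℕ} {T : TensorField n k}
    (hT : ∀ i, DifferentiableAt ℝ (fun w => T w i) u) (m : Fin n) :
    partialDeriv m (fun w => tensorInner (G w) (T w) (T w)) u
      = 2 * tensorInner (G u) (fun i => covDeriv G T u (Fin.cons m i)) (T u) := by
  have hQ := fun i j => differentiableAt_kronPow_inv hG hu (k := k) i j
  have h1 : partialDeriv m (fun w => tensorInner (G w) (T w) (T w)) u
      = tensorInner (G u) (fun i => partialDeriv m (fun w => T w i) u) (T u)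
        + ∑ i, ∑ j, T u i * partialDeriv m (fun w => kronPow k (G w)⁻¹ i j) u * T u j
        + tensorInner (G u) (T u) (fun i => partialDeriv m (fun w => T w i) u) := by
    simp only [tensorInner_eq_sum_kronPow]
    rw [partialDeriv_sum _ fun i _ => DifferentiableAt.fun_sum fun j _ =>
      ((hT i).fun_mul (hQ i j)).fun_mul (hT j)]
    simp only [← Finset.sum_add_distrib]
    refine Finset.sum_congr rfl fun i _ => ?_
    rw [partialDeriv_sum _ fun j _ => ((hT i).fun_mul (hQ i j)).fun_mul (hT j)]
    refine Finset.sum_congr rfl fun j _ => ?_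
    rw [partialDeriv_mul ((hT i).fun_mul (hQ i j)) (hT j), partialDeriv_mul (hT i) (hQ i j)]
    ring
  -- By adjointness, differentiating the inverse metrics yields exactly the Christoffel terms that
  -- complete the partial derivatives of `T` to covariant ones.
  have h2 : ∑ i, ∑ j, T u i * partialDeriv m (fun w => kronPow k (G w)⁻¹ i j) u * T u j
      = -(tensorInner (G u) (tensorDerivation (connMat G m u) (T u)) (T u)
        + tensorInner (G u) (T u) (tensorDerivation (connMat G m u) (T u))) := by
    simp only [partialDeriv_kronPow_inv hG hs hu, mul_neg, neg_mul, Finset.sum_neg_distrib, mul_add,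
      add_mul, Finset.sum_add_distrib, tensorInner_eq_sum_kronPow]
    congr 2
    · rw [Finset.sum_comm, Finset.sum_comm (f := fun i j =>
        tensorDerivation (connMat G m u) (T u) i * kronPow k (G u)⁻¹ i j * T u j)]
      refine Finset.sum_congr rfl fun j _ => ?_
      rw [← Finset.sum_mul, ← Finset.sum_mul, sum_mul_tensorDerivation_transpose]
    · refine Finset.sum_congr rfl fun i _ => ?_
      simp only [mul_assoc, ← Finset.mul_sum]
      congr 1
      rw [Finset.sum_congr rfl fun j _ => mul_comm _ (T u j), sum_mul_tensorDerivation_transpose]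
      exact Finset.sum_congr rfl fun j _ => mul_comm _ _
  simp only [covDeriv_cons, tensorInner_sub_left]
  rw [h1, h2, tensorInner_comm (hs u) (T u), tensorInner_comm (hs u) (T u)]
  ring

/-- The first slot of the inner product raises the index of `ξ`, so pairing with `ξ ⊗ t` contracts
the first slot of `s` with the raised vector. -/
theorem tensorInner_mul_tail (A : Matrix (Fin n) (Fin n) ℝ) {k : ℕ}
    (s : (Fin (k + 1) → Fin n) → ℝ) (ξ : Fin n → ℝ) (t : (Fin k → Fin n) → ℝ) :
    tensorInner A s (fun i => ξ (i 0) * t (Fin.tail i))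
      = ∑ m, (A⁻¹.mulVec ξ) m * tensorInner A (fun i => s (Fin.cons m i)) t := by
  simp only [tensorInner_eq_sum_kronPow, sum_fin_succ_arrow, kronPow_apply, Fin.prod_univ_succ,
    Fin.cons_zero, Fin.tail_cons, Fin.cons_succ, Matrix.mulVec, dotProduct, Finset.sum_mul,
    Finset.mul_sum]
  refine Finset.sum_congr rfl fun m _ => Finset.sum_congr rfl fun i _ => ?_
  rw [Finset.sum_comm]
  exact Finset.sum_congr rfl fun j _ => Finset.sum_congr rfl fun l _ => by ring

theorem tensorInner_smul_left (A : Matrix (Fin n) (Fin n) ℝ) {k : ℕ} (c : ℝ)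
    (s t : (Fin k → Fin n) → ℝ) :
    tensorInner A (fun i => c * s i) t = c * tensorInner A s t := by
  rw [tensorInner, show (fun i => c * s i) = c • s from rfl, smul_dotProduct]; rfl

/-- The Kato inequality. -/
theorem abs_fderiv_tensorInner_le (hG : SmoothAt G u) (hs : ∀ w, (G w).transpose = G w)
    (hpos : (G u).PosDef) {k : ℕ} {T : TensorField n k}
    (hT : ∀ i, DifferentiableAt ℝ (fun w => T w i) u) (X : EuclideanSpace ℝ (Fin n)) :
    |fderiv ℝ (fun w => tensorInner (G w) (T w) (T w)) u X|
      ≤ 2 * (tensorNorm (G u) (covDeriv G T u) *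
        (Real.sqrt (X.ofLp ⬝ᵥ (G u).mulVec X.ofLp) * tensorNorm (G u) (T u))) := by
  have hu : IsUnit (G u).det := isUnit_iff_ne_zero.2 hpos.det_pos.ne'
  -- `ξ` is `X♭` and `S` below is `X♭ ⊗ T`. Cauchy–Schwarz is applied to the `(k + 1)`-tensors `∇T`
  -- and `S`, where `|S| = |X| |T|`, so the contraction `∇_X T` needs no separate estimate.
  set ξ : Fin n → ℝ := (G u).mulVec X.ofLp with hξ
  have hX : (G u)⁻¹.mulVec ξ = X.ofLp := by
    rw [hξ, Matrix.mulVec_mulVec, Matrix.nonsing_inv_mul _ hu, Matrix.one_mulVec]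
  set S : (Fin (k + 1) → Fin n) → ℝ := fun i => ξ (i 0) * T u (Fin.tail i) with hS
  have h1 : fderiv ℝ (fun w => tensorInner (G w) (T w) (T w)) u X
      = 2 * tensorInner (G u) (covDeriv G T u) S := by
    rw [fderiv_eq_sum_partialDeriv, tensorInner_mul_tail, hX, Finset.mul_sum]
    refine Finset.sum_congr rfl fun m _ => ?_
    rw [partialDeriv_tensorInner hG hs hu hT]; ring
  have h2 : tensorNorm (G u) S = Real.sqrt (X.ofLp ⬝ᵥ ξ) * tensorNorm (G u) (T u) := by
    have h3 : tensorInner (G u) S S = (X.ofLp ⬝ᵥ ξ) * tensorInner (G u) (T u) (T u) := by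
      conv_lhs => rw [hS]
      rw [tensorInner_mul_tail, hX, dotProduct, Finset.sum_mul]
      refine Finset.sum_congr rfl fun m _ => ?_
      simp only [Fin.cons_zero, Fin.tail_cons, tensorInner_smul_left]
      ring
    have h4 : 0 ≤ X.ofLp ⬝ᵥ ξ := by
      have := hpos.posSemidef.dotProduct_mulVec_nonneg X.ofLp
      simpa using this
    rw [tensorNorm_eq_sqrt, h3, Real.sqrt_mul h4, tensorNorm_eq_sqrt]
  rw [h1, abs_mul, abs_two, ← h2]
  exact mul_le_mul_of_nonneg_left (abs_tensorInner_le hpos _ _) zero_le_two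

theorem SmoothAt.riemann (hG : SmoothAt G u) (hu : IsUnit (G u).det) (i : Fin 4 → Fin n) :
    ContDiffAt ℝ ∞ (fun w => riemann G w i) u := by
  simp only [riemann_eq]
  exact (hG.transpose.mul (hG.curvMat hu (i 0) (i 1))) (i 3) (i 2)

end LocalCoord

namespace RiemannianGeometry

open LocalCoord

variable {n : ℕ} {M : Type*} [EMetricSpace M] [ChartedSpace (EuclideanSpace ℝ (Fin n)) M]
  [RiemannianBundle (fun x : M => TangentSpace (𝓡 n) x)]

/-! ### The metric in a chart -/

theorem metricMatrix_transpose (c : M) (u : EuclideanSpace ℝ (Fin n)) :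
    (metricMatrix c u).transpose = metricMatrix c u := by
  ext i j
  exact real_inner_comm (coordVector c i u) (coordVector c j u)

theorem inner_mfderiv_symm (c : M) (u X Y : EuclideanSpace ℝ (Fin n)) :
    inner ℝ (mfderiv (𝓡 n) (𝓡 n) (extChartAt (𝓡 n) c).symm u X)
      (mfderiv (𝓡 n) (𝓡 n) (extChartAt (𝓡 n) c).symm u Y)
      = X.ofLp ⬝ᵥ (metricMatrix c u).mulVec Y.ofLp := by
  have h : ∀ Z : EuclideanSpace ℝ (Fin n),
      mfderiv (𝓡 n) (𝓡 n) (extChartAt (𝓡 n) c).symm u Z = ∑ i, Z i • coordVector c i u := by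
    intro Z
    have hZ : Z = ∑ i, Z i • EuclideanSpace.single i (1 : ℝ) := by
      ext j; simp [Pi.single_apply]
    conv_lhs => rw [hZ]
    exact (map_sum _ _ _).trans (Finset.sum_congr rfl fun i _ => map_smul _ _ _)
  rw [h X, h Y, sum_inner]
  simp only [inner_sum, inner_smul_left, inner_smul_right, dotProduct, Matrix.mulVec,
    Finset.mul_sum, metricMatrix, Matrix.of_apply]
  exact Finset.sum_congr rfl fun i _ => Finset.sum_congr rfl fun j _ => by simp; ring

variable [IsManifold (𝓡 n) ∞ M]

theorem contMDiffAt_extChartAt_symm {c : M} {u : EuclideanSpace ℝ (Fin n)}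
    (hu : u ∈ (extChartAt (𝓡 n) c).target) :
    ContMDiffAt (𝓡 n) (𝓡 n) ∞ (extChartAt (𝓡 n) c).symm u :=
  (contMDiffOn_extChartAt_symm c).contMDiffAt ((isOpen_extChartAt_target c).mem_nhds hu)

theorem mfderiv_symm_mfderiv {c y : M} (hy : y ∈ (extChartAt (𝓡 n) c).source)
    (v : TangentSpace (𝓡 n) y) :
    (mfderiv (𝓡 n) (𝓡 n) (extChartAt (𝓡 n) c).symm (extChartAt (𝓡 n) c y)
      (mfderiv (𝓡 n) (𝓡 n) (extChartAt (𝓡 n) c) y v) : EuclideanSpace ℝ (Fin n)) = v := by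
  have h := mfderivWithin_extChartAt_symm_comp_mfderiv_extChartAt' (I := 𝓡 n) hy
  rw [ModelWithCorners.range_eq_univ, mfderivWithin_univ] at h
  exact congrArg (fun L : EuclideanSpace ℝ (Fin n) →L[ℝ] EuclideanSpace ℝ (Fin n) => L v) h

theorem mfderiv_symm_injective {c : M} {u : EuclideanSpace ℝ (Fin n)}
    (hu : u ∈ (extChartAt (𝓡 n) c).target) :
    Function.Injective (mfderiv (𝓡 n) (𝓡 n) (extChartAt (𝓡 n) c).symm u) := by
  have h := isInvertible_mfderivWithin_extChartAt_symm (I := 𝓡 n) hu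
  rw [ModelWithCorners.range_eq_univ, mfderivWithin_univ] at h
  exact h.injective

theorem posDef_metricMatrix {c : M} {u : EuclideanSpace ℝ (Fin n)}
    (hu : u ∈ (extChartAt (𝓡 n) c).target) : (metricMatrix c u).PosDef := by
  refine Matrix.PosDef.of_dotProduct_mulVec_pos ?_ fun x hx => ?_
  · rw [Matrix.IsHermitian, Matrix.conjTranspose_eq_transpose_of_trivial, metricMatrix_transpose]
  · have h := inner_mfderiv_symm c u (WithLp.toLp 2 x) (WithLp.toLp 2 x)
    simp only [star_trivial]
    rw [← h]
    refine real_inner_self_pos.2 fun h0 => hx ?_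
    have := mfderiv_symm_injective hu (h0.trans (map_zero _).symm)
    exact congrArg WithLp.ofLp this

/-- The coordinate fields are smooth sections, being images of constant sections under the tangent
map of the inverse chart, and the bundle metric pairs smooth sections smoothly. -/
theorem smoothAt_metricMatrix
    [IsContMDiffRiemannianBundle (𝓡 n) ∞ (EuclideanSpace ℝ (Fin n))
      (fun x : M => TangentSpace (𝓡 n) x)]
    {c : M} {u : EuclideanSpace ℝ (Fin n)}
    (hu : u ∈ (extChartAt (𝓡 n) c).target) : SmoothAt (metricMatrix c) u := by
  have hopen := isOpen_extChartAt_target (I := 𝓡 n) c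
  have hsec : ∀ i, ContMDiffAt (𝓡 n) ((𝓡 n).prod 𝓘(ℝ, EuclideanSpace ℝ (Fin n))) ∞
      (fun w => (⟨(extChartAt (𝓡 n) c).symm w, coordVector c i w⟩ :
        TotalSpace (EuclideanSpace ℝ (Fin n)) (TangentSpace (𝓡 n) : M → Type _))) u := by
    intro i
    have h1 := (contMDiffOn_extChartAt_symm (I := 𝓡 n) (n := ∞) c).contMDiffOn_tangentMapWithin
      (m := ∞) (by simp) hopen.uniqueMDiffOn
    have h2 : ContMDiff (𝓡 n) ((𝓡 n).prod 𝓘(ℝ, EuclideanSpace ℝ (Fin n))) ∞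
        (fun w : EuclideanSpace ℝ (Fin n) =>
          (⟨w, (EuclideanSpace.single i (1 : ℝ) : EuclideanSpace ℝ (Fin n))⟩ :
            TangentBundle (𝓡 n) (EuclideanSpace ℝ (Fin n)))) :=
      contMDiff_vectorSpace_iff_contDiff.2 contDiff_const
    have h3 := (h1.comp (h2.contMDiffOn (s := (extChartAt (𝓡 n) c).target))
      (fun w hw => hw)).contMDiffAt (hopen.mem_nhds hu)
    refine h3.congr_of_eventuallyEq ?_
    filter_upwards [hopen.mem_nhds hu] with w hw
    simp only [Function.comp, tangentMapWithin, coordVector]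
    rw [mfderivWithin_of_isOpen hopen hw]
  intro i j
  exact ((hsec i).inner_bundle (hsec j)).contDiffAt

variable [IsContMDiffRiemannianBundle (𝓡 n) ∞ (EuclideanSpace ℝ (Fin n))
  (fun x : M => TangentSpace (𝓡 n) x)]

theorem isUnit_det_metricMatrix {c : M} {u : EuclideanSpace ℝ (Fin n)}
    (hu : u ∈ (extChartAt (𝓡 n) c).target) : IsUnit (metricMatrix c u).det :=
  isUnit_iff_ne_zero.2 (posDef_metricMatrix hu).det_pos.ne'

/-- All tangent spaces have the model space as underlying type, but the inner product depends on the
base point. This handles base points that agree only propositionally, such as a point and its image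
under a chart followed by the inverse chart. -/
theorem inner_congr_point {p q : M} (h : p = q) (v w : EuclideanSpace ℝ (Fin n)) :
    @inner ℝ (TangentSpace (𝓡 n) p) _ v w = @inner ℝ (TangentSpace (𝓡 n) q) _ v w := by
  subst h; rfl

theorem inner_mfderiv_symm_mfderiv {c y : M} (hy : y ∈ (extChartAt (𝓡 n) c).source)
    (v : TangentSpace (𝓡 n) y) :
    inner ℝ (mfderiv (𝓡 n) (𝓡 n) (extChartAt (𝓡 n) c).symm (extChartAt (𝓡 n) c y)
        (mfderiv (𝓡 n) (𝓡 n) (extChartAt (𝓡 n) c) y v))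
      (mfderiv (𝓡 n) (𝓡 n) (extChartAt (𝓡 n) c).symm (extChartAt (𝓡 n) c y)
        (mfderiv (𝓡 n) (𝓡 n) (extChartAt (𝓡 n) c) y v)) = inner ℝ v v :=
  (inner_congr_point ((extChartAt (𝓡 n) c).left_inv hy) _ _).trans
    (by rw [mfderiv_symm_mfderiv hy v])

/-- The metric matrices in two charts are related by the transition map. -/
theorem isPullback_metricMatrix (c y : M) :
    IsPullback (fun w => extChartAt (𝓡 n) c ((extChartAt (𝓡 n) y).symm w))
      (metricMatrix c) (metricMatrix y)
      ((extChartAt (𝓡 n) y).target ∩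
        (extChartAt (𝓡 n) y).symm ⁻¹' (extChartAt (𝓡 n) c).source) := by
  set φ : EuclideanSpace ℝ (Fin n) → EuclideanSpace ℝ (Fin n) :=
    fun w => extChartAt (𝓡 n) c ((extChartAt (𝓡 n) y).symm w) with hφ
  set V := (extChartAt (𝓡 n) y).target ∩
    (extChartAt (𝓡 n) y).symm ⁻¹' (extChartAt (𝓡 n) c).source with hV
  have hopen : IsOpen V := (continuousOn_extChartAt_symm y).isOpen_inter_preimage
    (isOpen_extChartAt_target y) (isOpen_extChartAt_source c)
  have hsm : ∀ w ∈ V, ContDiffAt ℝ ∞ φ w := fun w hw => by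
    have h1 : ContMDiffAt (𝓡 n) (𝓡 n) ∞ (extChartAt (𝓡 n) c)
        ((extChartAt (𝓡 n) y).symm w) :=
      contMDiffAt_extChartAt' (by simpa using hw.2)
    exact (h1.comp w (contMDiffAt_extChartAt_symm hw.1)).contDiffAt
  have hmem : ∀ w ∈ V, φ w ∈ (extChartAt (𝓡 n) c).target := fun w hw =>
    (extChartAt (𝓡 n) c).map_source hw.2
  have hpt : ∀ w ∈ V, (extChartAt (𝓡 n) c).symm (φ w) = (extChartAt (𝓡 n) y).symm w :=
    fun w hw => (extChartAt (𝓡 n) c).left_inv hw.2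
  have heq : ∀ w ∈ V, metricMatrix y w
      = (jacobian φ w).transpose * metricMatrix c (φ w) * jacobian φ w := by
    intro w hw
    have hd : ∀ X : EuclideanSpace ℝ (Fin n),
        (mfderiv (𝓡 n) (𝓡 n) (extChartAt (𝓡 n) y).symm w X : EuclideanSpace ℝ (Fin n))
          = mfderiv (𝓡 n) (𝓡 n) (extChartAt (𝓡 n) c).symm (φ w) (fderiv ℝ φ w X) := by
      intro X
      have he : (extChartAt (𝓡 n) y).symm =ᶠ[nhds w] (extChartAt (𝓡 n) c).symm ∘ φ :=
        Filter.eventually_of_mem (hopen.mem_nhds hw) fun x hx => (hpt x hx).symm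
      rw [he.mfderiv_eq, mfderiv_comp w
        ((contMDiffAt_extChartAt_symm (hmem w hw)).mdifferentiableAt (by simp))
        ((hsm w hw).contMDiffAt.mdifferentiableAt (by simp)), mfderiv_eq_fderiv]
      rfl
    have hJ : ∀ i a, (fderiv ℝ φ w (EuclideanSpace.single i 1)) a = jacobian φ w a i := by
      intro i a
      have : HasFDerivAt (fun w => φ w a)
          ((EuclideanSpace.proj a : EuclideanSpace ℝ (Fin n) →L[ℝ] ℝ).comp (fderiv ℝ φ w)) w :=
        (EuclideanSpace.proj a : EuclideanSpace ℝ (Fin n) →L[ℝ] ℝ).hasFDerivAt.comp w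
          ((hsm w hw).differentiableAt (by simp)).hasFDerivAt
      rw [jacobian, Matrix.of_apply, partialDeriv, this.fderiv]; rfl
    ext i j
    have h1 := inner_mfderiv_symm c (φ w) (fderiv ℝ φ w (EuclideanSpace.single i 1))
      (fderiv ℝ φ w (EuclideanSpace.single j 1))
    have h2 : metricMatrix y w i j
        = inner ℝ (mfderiv (𝓡 n) (𝓡 n) (extChartAt (𝓡 n) c).symm (φ w)
            (fderiv ℝ φ w (EuclideanSpace.single i 1)))
          (mfderiv (𝓡 n) (𝓡 n) (extChartAt (𝓡 n) c).symm (φ w)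
            (fderiv ℝ φ w (EuclideanSpace.single j 1))) := by
      rw [← hd, ← hd]
      exact (inner_congr_point (hpt w hw) _ _).symm
    rw [h2, h1, Matrix.mul_assoc]
    simp only [Matrix.mul_apply, dotProduct, Matrix.mulVec, hJ, Matrix.transpose_apply]
  refine ⟨hopen, hsm, fun w hw => ?_, fun w hw => smoothAt_metricMatrix (hmem w hw),
    fun w hw => isUnit_det_metricMatrix (hmem w hw), metricMatrix_transpose c,
    metricMatrix_transpose y, heq⟩
  have h := isUnit_det_metricMatrix hw.1
  rw [heq w hw, Matrix.det_mul] at h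
  exact isUnit_of_mul_isUnit_right h

/-! ### The norm of the curvature in a fixed chart and along curves -/

/-- The function `|Rm|` can be computed in any chart. -/
theorem normRm_eq_tensorNorm {c y : M} (hy : y ∈ (extChartAt (𝓡 n) c).source) :
    normRm n y = tensorNorm (metricMatrix c (extChartAt (𝓡 n) c y))
      (riemann (metricMatrix c) (extChartAt (𝓡 n) c y)) := by
  -- `normRm n y` is defined in the chart at `y`, so the transition map to the chart at `c` is used
  -- at the coordinates of `y` in its own chart.
  have h := (isPullback_metricMatrix c y).tensorNorm_riemann (w := extChartAt (𝓡 n) y y)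
    ⟨mem_extChartAt_target y, by simpa [extChartAt_to_inv] using hy⟩
  rw [extChartAt_to_inv] at h
  exact h

/-- The square of `|Rm|` in coordinates. -/
noncomputable def chartNormRmSq (c : M) (u : EuclideanSpace ℝ (Fin n)) : ℝ :=
  tensorInner (metricMatrix c u) (riemann (metricMatrix c) u) (riemann (metricMatrix c) u)

theorem normRm_sq_eq {c y : M} (hy : y ∈ (extChartAt (𝓡 n) c).source) :
    normRm n y ^ 2 = chartNormRmSq c (extChartAt (𝓡 n) c y) := by
  rw [normRm_eq_tensorNorm hy, tensorNorm_eq_sqrt, Real.sq_sqrt]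
  · rfl
  · exact tensorInner_self_nonneg (posDef_metricMatrix ((extChartAt (𝓡 n) c).map_source hy)) _

theorem differentiableAt_chartNormRmSq {c : M} {u : EuclideanSpace ℝ (Fin n)}
    (hu : u ∈ (extChartAt (𝓡 n) c).target) : DifferentiableAt ℝ (chartNormRmSq c) u :=
  differentiableAt_tensorInner (smoothAt_metricMatrix hu) (isUnit_det_metricMatrix hu) fun i =>
    ((smoothAt_metricMatrix hu).riemann (isUnit_det_metricMatrix hu) i).differentiableAt (by simp)

theorem normRm_nonneg (y : M) : 0 ≤ normRm n y := Real.sqrt_nonneg _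

theorem continuous_normRm : Continuous (normRm n : M → ℝ) := by
  refine continuous_iff_continuousAt.2 fun c => ?_
  have h1 : ContinuousAt (fun y : M => chartNormRmSq c (extChartAt (𝓡 n) c y)) c :=
    (differentiableAt_chartNormRmSq (mem_extChartAt_target c)).continuousAt.comp
      (continuousAt_extChartAt c)
  have h2 : normRm n =ᶠ[nhds c] fun y : M => Real.sqrt
      (chartNormRmSq c (extChartAt (𝓡 n) c y)) := by
    filter_upwards [extChartAt_source_mem_nhds (I := 𝓡 n) c] with y hy
    rw [← normRm_sq_eq hy, Real.sqrt_sq (normRm_nonneg y)]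
  exact h1.sqrt.congr h2.symm

/-- Along a curve, `|Rm|²` has derivative bounded by `2 |∇Rm| |Rm|` times the speed. -/
theorem exists_hasDerivAt_normRm_sq {γ : ℝ → M} {t : ℝ}
    (hγ : MDifferentiableAt 𝓘(ℝ, ℝ) (𝓡 n) γ t) :
    ∃ d, HasDerivAt (fun s => normRm n (γ s) ^ 2) d t ∧
      |d| ≤ 2 * (normIterCovDerivRm n 1 (γ t) *
        (‖mfderiv 𝓘(ℝ, ℝ) (𝓡 n) γ t (1 : ℝ)‖ * normRm n (γ t))) := by
  set c := γ t with hc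
  have hcs : c ∈ (extChartAt (𝓡 n) c).source := mem_extChartAt_source c
  have hct : extChartAt (𝓡 n) c c ∈ (extChartAt (𝓡 n) c).target := mem_extChartAt_target c
  have he : MDifferentiableAt (𝓡 n) (𝓡 n) (extChartAt (𝓡 n) c) (γ t) :=
    mdifferentiableAt_extChartAt (mem_chart_source _ c)
  set X : EuclideanSpace ℝ (Fin n) := mfderiv (𝓡 n) (𝓡 n) (extChartAt (𝓡 n) c) (γ t)
    (mfderiv 𝓘(ℝ, ℝ) (𝓡 n) γ t (1 : ℝ)) with hX
  have hu : HasDerivAt (fun s => extChartAt (𝓡 n) c (γ s)) X t := by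
    have h1 : DifferentiableAt ℝ (extChartAt (𝓡 n) c ∘ γ) t :=
      mdifferentiableAt_iff_differentiableAt.1 (he.comp t hγ)
    have h2 : fderiv ℝ (extChartAt (𝓡 n) c ∘ γ) t (1 : ℝ) = X := by
      rw [← mfderiv_eq_fderiv, mfderiv_comp t he hγ]
      rfl
    exact h2 ▸ h1.hasFDerivAt.hasDerivAt
  have hN := (differentiableAt_chartNormRmSq hct).hasFDerivAt.comp_hasDerivAt t hu
  refine ⟨_, hN.congr_of_eventuallyEq ?_, ?_⟩
  · filter_upwards [hγ.continuousAt.preimage_mem_nhds (extChartAt_source_mem_nhds (I := 𝓡 n) c)]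
      with s hs
    exact normRm_sq_eq hs
  · have hk := abs_fderiv_tensorInner_le (smoothAt_metricMatrix hct) (metricMatrix_transpose c)
      (posDef_metricMatrix hct) (T := riemann (metricMatrix c))
      (fun i => ((smoothAt_metricMatrix hct).riemann (isUnit_det_metricMatrix hct)
        i).differentiableAt (by simp)) X
    -- The coordinate length of `X`, measured with the metric matrix, is the speed of `γ`.
    have hXn : Real.sqrt (X.ofLp ⬝ᵥ (metricMatrix c (extChartAt (𝓡 n) c c)).mulVec X.ofLp)
        = ‖mfderiv 𝓘(ℝ, ℝ) (𝓡 n) γ t (1 : ℝ)‖ := by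
      rw [← inner_mfderiv_symm c, norm_eq_sqrt_real_inner, hX]
      congr 1
      exact inner_mfderiv_symm_mfderiv hcs (mfderiv 𝓘(ℝ, ℝ) (𝓡 n) γ t (1 : ℝ))
    rw [hXn] at hk
    exact hk

end RiemannianGeometry

/-! ### Point picking -/

/-- The point-picking lemma: in a complete space, near every point at which a continuous function
`f` is positive there is a point `y` such that `f ≤ 4 f(y)` on a ball whose radius is a given multiple
of `f(y)^(-1/2)`. -/
theorem exists_edist_lt_forall_le_four_mul {X : Type*} [PseudoEMetricSpace X] [CompleteSpace X]
    {f : X → ℝ} (hf : Continuous f) {z : X} (hz : 0 < f z) {A : ℝ} (hA : 0 < A) :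
    ∃ y, edist z y < ENNReal.ofReal (2 * (A / √(f z))) ∧ f z ≤ f y ∧
      ∀ w, edist y w < ENNReal.ofReal (A / √(f y)) → f w ≤ 4 * f y := by
  by_contra! hcon
  set D := A / √(f z) with hD
  have hDpos : 0 < D := div_pos hA (Real.sqrt_pos.2 hz)
  -- If no such point exists, each candidate has a neighbour within `A / √f` at which `f` is more
  -- than four times larger. The step lengths are thus at most `D / 2 ^ k`; their partial sums `2 D
  -- (1 - 2⁻ᵏ)` stay below the allowed distance `2 D`.
  let P : ℕ → X → Prop := fun k y =>
    edist z y ≤ ENNReal.ofReal (2 * D * (1 - (1 / 2) ^ k)) ∧ 4 ^ k * f z ≤ f y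
  have hstep : ∀ k y, P k y → ∃ w, P (k + 1) w ∧
      edist y w ≤ ENNReal.ofReal (D * (1 / 2) ^ k) := by
    rintro k y ⟨h1, h2⟩
    have hk : (0 : ℝ) < (1 / 2) ^ k := by positivity
    have hk1 : ((1 : ℝ) / 2) ^ k ≤ 1 := pow_le_one₀ (by norm_num) (by norm_num)
    have h4 : (1 : ℝ) ≤ 4 ^ k := one_le_pow₀ (by norm_num)
    obtain ⟨w, hw1, hw2⟩ := hcon y
      (h1.trans_lt ((ENNReal.ofReal_lt_ofReal_iff (by positivity)).2 (by nlinarith)))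
      (le_trans (by nlinarith) h2)
    have hsq : 2 ^ k * √(f z) ≤ √(f y) := by
      apply Real.le_sqrt_of_sq_le
      rw [mul_pow, Real.sq_sqrt hz.le, ← pow_mul, mul_comm k, pow_mul]
      norm_num
      exact h2
    have hle : A / √(f y) ≤ D * (1 / 2) ^ k := by
      have hpos : 0 < √(f z) := Real.sqrt_pos.2 hz
      calc A / √(f y) ≤ A / (2 ^ k * √(f z)) := by gcongr
        _ = D * (1 / 2) ^ k := by rw [hD, div_pow, one_pow]; field_simp
    have hd : edist y w ≤ ENNReal.ofReal (D * (1 / 2) ^ k) :=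
      hw1.le.trans (ENNReal.ofReal_le_ofReal hle)
    refine ⟨w, ⟨?_, ?_⟩, hd⟩
    · refine (edist_triangle z y w).trans ((add_le_add h1 hd).trans ?_)
      rw [← ENNReal.ofReal_add (mul_nonneg (by positivity) (by linarith)) (by positivity)]
      apply ENNReal.ofReal_le_ofReal
      rw [pow_succ]
      nlinarith
    · rw [pow_succ]; linarith
  choose next hnext hdist using hstep
  let seq : (k : ℕ) → {y // P k y} := fun k =>
    Nat.rec ⟨z, by simp [P]⟩ (fun k y => ⟨next k y.1 y.2, hnext k y.1 y.2⟩) k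
  have hsum : Summable fun k : ℕ => (D * (1 / 2) ^ k).toNNReal :=
    (summable_geometric_two.mul_left D).toNNReal
  have hcauchy : CauchySeq fun k => (seq k).1 :=
    cauchySeq_of_edist_le_of_summable _ (fun k => hdist k (seq k).1 (seq k).2) hsum
  obtain ⟨y, hy⟩ := cauchySeq_tendsto_of_complete hcauchy
  -- Along the convergent sequence `f ≥ 4 ^ k f z` is unbounded, against continuity of `f` at the
  -- limit.
  refine not_tendsto_nhds_of_tendsto_atTop ?_ (f y) ((hf.tendsto y).comp hy)
  exact Filter.tendsto_atTop_mono (fun k => (seq k).2.2)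
    ((tendsto_pow_atTop_atTop_of_one_lt (by norm_num)).atTop_mul_const hz)

namespace RiemannianGeometry

open LocalCoord MeasureTheory

variable {n : ℕ} {M : Type*} [EMetricSpace M] [ChartedSpace (EuclideanSpace ℝ (Fin n)) M]
  [RiemannianBundle (fun x : M => TangentSpace (𝓡 n) x)] [IsManifold (𝓡 n) ∞ M]
  [IsContMDiffRiemannianBundle (𝓡 n) ∞ (EuclideanSpace ℝ (Fin n))
    (fun x : M => TangentSpace (𝓡 n) x)]

/-! ### The gradient estimate -/

theorem continuous_norm_velocity {γ : ℝ → M} (hγ : ContMDiff 𝓘(ℝ, ℝ) (𝓡 n) 1 γ) :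
    Continuous fun t => ‖mfderiv 𝓘(ℝ, ℝ) (𝓡 n) γ t (1 : ℝ)‖ := by
  have : IsContMDiffRiemannianBundle (𝓡 n) 0 (EuclideanSpace ℝ (Fin n))
      (fun x : M => TangentSpace (𝓡 n) x) :=
    IsContMDiffRiemannianBundle.of_le (n := ∞) (by simp)
  have h1 : ContMDiff 𝓘(ℝ, ℝ) (𝓘(ℝ, ℝ).prod 𝓘(ℝ, ℝ)) 0
      fun t : ℝ => (⟨t, (1 : ℝ)⟩ : TangentBundle 𝓘(ℝ, ℝ) ℝ) :=
    contMDiff_vectorSpace_iff_contDiff.2 contDiff_const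
  have h2 : ContMDiff 𝓘(ℝ, ℝ) ((𝓡 n).prod 𝓘(ℝ, EuclideanSpace ℝ (Fin n))) 0
      fun t : ℝ => (⟨γ t, mfderiv 𝓘(ℝ, ℝ) (𝓡 n) γ t (1 : ℝ)⟩ :
        TotalSpace (EuclideanSpace ℝ (Fin n)) (TangentSpace (𝓡 n) : M → Type _)) :=
    (hγ.contMDiff_tangentMap (by simp)).comp h1
  simp only [norm_eq_sqrt_real_inner]
  exact (h2.inner_bundle h2).continuous.sqrt

/-- `|Rm|` need not be differentiable where it vanishes. The shift by `η ^ 2` restores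
differentiability, and since `|Rm|` is at most the regularised root, the derivative bound does not
involve `η`. -/
theorem exists_hasDerivAt_sqrt_normRm_sq_add {γ : ℝ → M} {t η : ℝ} (hη : 0 < η)
    (hγ : MDifferentiableAt 𝓘(ℝ, ℝ) (𝓡 n) γ t) :
    ∃ d, HasDerivAt (fun s => √(normRm n (γ s) ^ 2 + η ^ 2)) d t ∧
      |d| ≤ normIterCovDerivRm n 1 (γ t) * ‖mfderiv 𝓘(ℝ, ℝ) (𝓡 n) γ t (1 : ℝ)‖ := by
  obtain ⟨d, hd, hle⟩ := exists_hasDerivAt_normRm_sq hγ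
  have hpos : 0 < normRm n (γ t) ^ 2 + η ^ 2 := by positivity
  have hs : 0 < √(normRm n (γ t) ^ 2 + η ^ 2) := Real.sqrt_pos.2 hpos
  refine ⟨_, (hd.add_const (η ^ 2)).sqrt hpos.ne', ?_⟩
  rw [abs_div, abs_of_pos (mul_pos two_pos hs), div_le_iff₀ (mul_pos two_pos hs)]
  have h1 : normRm n (γ t) ≤ √(normRm n (γ t) ^ 2 + η ^ 2) :=
    Real.le_sqrt_of_sq_le (by nlinarith [sq_nonneg η])
  have h2 : 0 ≤ normIterCovDerivRm n 1 (γ t) := Real.sqrt_nonneg _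
  have h3 := mul_le_mul_of_nonneg_left h1
    (mul_nonneg h2 (norm_nonneg (mfderiv 𝓘(ℝ, ℝ) (𝓡 n) γ t (1 : ℝ))))
  linarith

/-- Integrate the gradient bound along a `C¹` curve from `y₀` to `y` of length less than `ρ`; such a
curve cannot leave the ball on which the bound holds. -/
theorem normRm_le_add_mul [IsRiemannianManifold (𝓡 n) M] {y₀ y : M} {K R ρ : ℝ} (hK : 0 ≤ K)
    (hρ : 0 < ρ) (hρR : ρ ≤ R)
    (hbound : ∀ w ∈ Metric.eball y₀ (ENNReal.ofReal R), normIterCovDerivRm n 1 w ≤ K)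
    (hy : edist y₀ y < ENNReal.ofReal ρ) : normRm n y₀ ≤ normRm n y + K * ρ := by
  rw [IsRiemannianManifold.out (I := 𝓡 n) y₀ y] at hy
  obtain ⟨γ, h0, h1, hγ, hlen, -, -⟩ :=
    Manifold.exists_lt_locally_constant_of_riemannianEDist_lt hy zero_lt_one
  have hmd : ∀ t, MDifferentiableAt 𝓘(ℝ, ℝ) (𝓡 n) γ t := fun t =>
    hγ.mdifferentiableAt (by simp)
  set S : ℝ → ℝ := fun t => ‖mfderiv 𝓘(ℝ, ℝ) (𝓡 n) γ t (1 : ℝ)‖ with hS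
  have hSc : Continuous S := continuous_norm_velocity hγ
  have hmem : ∀ t ∈ Set.Icc (0 : ℝ) 1, γ t ∈ Metric.eball y₀ (ENNReal.ofReal R) := by
    intro t ht
    rw [Metric.mem_eball, edist_comm, IsRiemannianManifold.out (I := 𝓡 n) y₀]
    refine (Manifold.riemannianEDist_le_pathELength hγ.contMDiffOn h0 rfl ht.1).trans_lt
      ((Manifold.pathELength_mono le_rfl ht.2).trans_lt (hlen.trans_le ?_))
    exact ENNReal.ofReal_le_ofReal hρR
  have hint : ∫ t in (0 : ℝ)..1, S t ≤ ρ := by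
    have h : ENNReal.ofReal (∫ t in Set.Icc (0 : ℝ) 1, S t) < ENNReal.ofReal ρ := by
      rw [ofReal_integral_eq_lintegral_ofReal hSc.continuousOn.integrableOn_Icc
        (Filter.Eventually.of_forall fun t => norm_nonneg _)]
      rw [Manifold.pathELength_eq_lintegral_mfderiv_Icc] at hlen
      exact (setLIntegral_congr_fun measurableSet_Icc fun t _ => ofReal_norm _).trans_lt hlen
    rw [intervalIntegral.integral_of_le zero_le_one, ← integral_Icc_eq_integral_Ioc]
    exact ((ENNReal.ofReal_lt_ofReal_iff hρ).1 h).le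
  -- Comparing the regularised norms at the two ends costs at most `η`, which is arbitrary.
  refine le_of_forall_pos_le_add fun η hη => ?_
  have hd := fun t => exists_hasDerivAt_sqrt_normRm_sq_add hη (hmd t)
  choose d hd hdle using hd
  have hB : ∀ t, HasDerivAt (fun t => K * ∫ s in (0 : ℝ)..t, S s) (K * S t) t := fun t =>
    (intervalIntegral.integral_hasDerivAt_right (hSc.intervalIntegrable _ _)
      (hSc.stronglyMeasurableAtFilter _ _) hSc.continuousAt).const_mul K
  set H : ℝ → ℝ := fun s => √(normRm n (γ s) ^ 2 + η ^ 2) with hH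
  have hle := image_le_of_deriv_right_le_deriv_boundary (a := 0) (b := 1)
    (f := fun t => H 0 - H t) (f' := fun t => -d t) (B := fun t => K * ∫ s in (0 : ℝ)..t, S s)
    (B' := fun t => K * S t)
    (fun t _ => (((hd t).const_sub (H 0)).continuousAt).continuousWithinAt)
    (fun t _ => ((hd t).const_sub (H 0)).hasDerivWithinAt) (by simp)
    (fun t _ => (hB t).continuousAt.continuousWithinAt) (fun t _ => (hB t).hasDerivWithinAt)
    (fun t ht => (neg_le_abs _).trans ((hdle t).trans (mul_le_mul_of_nonneg_right
      (hbound _ (hmem t ⟨ht.1, ht.2.le⟩)) (norm_nonneg _))))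
    (Set.right_mem_Icc.2 zero_le_one)
  replace hle : H 0 - H 1 ≤ K * ∫ s in (0 : ℝ)..1, S s := hle
  have hH0 : normRm n y₀ ≤ H 0 := by
    rw [hH]; simp only [h0]
    exact Real.le_sqrt_of_sq_le (by nlinarith [sq_nonneg η])
  have hH1 : H 1 ≤ normRm n y + η := by
    rw [hH]; simp only [h1]
    have := normRm_nonneg (n := n) y
    exact Real.sqrt_le_iff.2 ⟨by linarith, by nlinarith⟩
  have := mul_le_mul_of_nonneg_left hint hK
  linarith

/-! ### The `ε`-regularity theorem -/

/-- In a metric which is `(Λ, 1)` regular, a bound `|Rm| ≤ 4 |Rm|(y₀)` near `y₀` implies a lower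
bound of `|Rm|` near `y₀`. -/
theorem IsRegular.le_normRm [IsRiemannianManifold (𝓡 n) M] {Λ : ℝ} (hΛ : 1 ≤ Λ)
    (hreg : IsRegular n M Λ 1) {y₀ : M} (h0 : 0 < normRm n y₀) {δ : ℝ} (hδ : 0 < δ) (hδ2 : δ < 2)
    (hle : ∀ w, edist y₀ w < ENNReal.ofReal (δ / 2 / √(normRm n y₀)) →
      normRm n w ≤ 4 * normRm n y₀) {w : M}
    (hw : edist y₀ w < ENNReal.ofReal (δ / (32 * Λ) / √(normRm n y₀))) :
    normRm n y₀ / 2 ≤ normRm n w := by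
  set q := √(normRm n y₀) with hq
  have hqpos : 0 < q := Real.sqrt_pos.2 h0
  have hqq : normRm n y₀ = q ^ 2 := (Real.sq_sqrt h0.le).symm
  have hΛ0 : 0 < Λ := by linarith
  -- The scale `1 / (2 q)` makes the curvature bound required by regularity equal to `4 q²`, and `δ
  -- < 2` makes the ratio `δ / 2` admissible. The result is `|∇Rm| ≤ 16 Λ q³ / δ` on the ball of
  -- radius `δ / (8 q)`; over the distance `δ / (32 Λ q)` this costs exactly `q² / 2`.
  have hgrad := hreg y₀ (1 / (2 * q)) (δ / 2) (by positivity) (by positivity) (by linarith)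
    (fun w hw => by
      rw [Metric.mem_eball, edist_comm] at hw
      refine (hle w (hw.trans_le (ENNReal.ofReal_le_ofReal ?_))).trans_eq ?_
      · rw [div_mul_div_comm, div_div, mul_one]
        gcongr
        linarith
      · rw [hqq]; field_simp; ring) 1 le_rfl le_rfl
  have hmain := normRm_le_add_mul (K := Λ / ((δ / 2 * (1 / (2 * q))) ^ 1 * (1 / (2 * q)) ^ 2))
    (by positivity) (ρ := δ / (32 * Λ) / q) (by positivity) (R := δ / 2 / 2 * (1 / (2 * q)))
    (by
      rw [show δ / 2 / 2 * (1 / (2 * q)) = δ / 8 / q by field_simp; ring]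
      gcongr
      linarith) hgrad hw
  have he : Λ / ((δ / 2 * (1 / (2 * q))) ^ 1 * (1 / (2 * q)) ^ 2) * (δ / (32 * Λ) / q)
      = q ^ 2 / 2 := by
    field_simp; ring
  rw [he] at hmain
  rw [hqq] at hmain ⊢
  linarith

end RiemannianGeometry

theorem theorem3p2 (n : ℕ) (hn : 0 < n) (Λ : ℝ) (hΛ : 1 ≤ Λ) :
    ∃ ε : ℝ, 0 < ε ∧
      ∀ (M : Type*) [EMetricSpace M] [CompleteSpace M]
        [ChartedSpace (EuclideanSpace ℝ (Fin n)) M] [IsManifold (𝓡 n) ∞ M]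
        [RiemannianBundle (fun x : M => TangentSpace (𝓡 n) x)]
        [IsContMDiffRiemannianBundle (𝓡 n) ∞ (EuclideanSpace ℝ (Fin n))
          (fun x : M => TangentSpace (𝓡 n) x)]
        [IsRiemannianManifold (𝓡 n) M]
        [MeasurableSpace M] [BorelSpace M],
        RiemannianGeometry.IsRegular n M Λ 1 →
        ∀ (x : M) (r v : ℝ), 0 < r → 0 < v →
          (∀ y ∈ Metric.eball x (ENNReal.ofReal (3 / 4 * r)), ∀ s : ℝ, 0 < s → s < r / 4 →
            ENNReal.ofReal (v * s ^ n) ≤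
              RiemannianGeometry.riemannianVolume n M (Metric.eball y (ENNReal.ofReal s))) →
          (∫⁻ y in Metric.eball x (ENNReal.ofReal r),
              ENNReal.ofReal (RiemannianGeometry.normRm n y ^ ((n : ℝ) / 2))
              ∂(RiemannianGeometry.riemannianVolume n M)) ≤ ENNReal.ofReal (ε * v) →
          ∀ z ∈ Metric.eball x (ENNReal.ofReal (1 / 2 * r)),
            RiemannianGeometry.normRm n z ≤
              16 / r ^ 2 *
                (1 / (v * ε) *
                  (∫⁻ y in Metric.eball x (ENNReal.ofReal r),
                    ENNReal.ofReal (RiemannianGeometry.normRm n y ^ ((n : ℝ) / 2))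
                    ∂(RiemannianGeometry.riemannianVolume n M)).toReal) ^ (2 / (n : ℝ)) := by
  have hΛ0 : 0 < Λ := by linarith
  -- With `s = δ / (32 Λ q)` one has `(q / 2) s = δ / (64 Λ)`, whose `n`-th power is `ε δ ^ n`.
  refine ⟨(1 / (64 * Λ)) ^ n, by positivity, ?_⟩
  intro M _ _ _ _ _ _ _ _ _ hreg x r v hr hv hvol hint z hz
  set ε : ℝ := (1 / (64 * Λ)) ^ n with hε
  have hεpos : 0 < ε := by positivity
  set μ := RiemannianGeometry.riemannianVolume n M
  set J := ∫⁻ y in Metric.eball x (ENNReal.ofReal r),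
    ENNReal.ofReal (RiemannianGeometry.normRm n y ^ ((n : ℝ) / 2)) ∂μ with hJ
  have hJtop : J ≠ ⊤ := (hint.trans_lt ENNReal.ofReal_lt_top).ne
  have hn0 : (n : ℝ) ≠ 0 := Nat.cast_ne_zero.2 hn.ne'
  have hJle : J.toReal ≤ ε * v := ENNReal.toReal_le_of_le_ofReal (by positivity) hint
  set δ₀ : ℝ := (1 / (v * ε) * J.toReal) ^ (1 / (n : ℝ)) with hδ₀
  have hbase : 0 ≤ 1 / (v * ε) * J.toReal := by positivity
  have hδ₀pos : 0 ≤ δ₀ := Real.rpow_nonneg hbase _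
  have hδ₀n : δ₀ ^ n = 1 / (v * ε) * J.toReal := by
    rw [hδ₀, one_div (n : ℝ), Real.rpow_inv_natCast_pow hbase hn.ne']
  have hδ₀1 : δ₀ ≤ 1 := by
    refine Real.rpow_le_one hbase ?_ (by positivity)
    rw [one_div_mul_eq_div, div_le_one (by positivity)]
    linarith
  have hrhs : (1 / (v * ε) * J.toReal) ^ (2 / (n : ℝ)) = δ₀ ^ 2 := by
    rw [hδ₀, ← Real.rpow_natCast _ 2, ← Real.rpow_mul hbase]
    congr 1
    push_cast
    ring
  rw [hrhs]
  by_contra! hlt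
  set f : M → ℝ := RiemannianGeometry.normRm n with hf
  have hz0 : 0 < f z := lt_of_le_of_lt (by positivity) hlt
  have hqz : 0 < √(f z) := Real.sqrt_pos.2 hz0
  have hδ₀lt : δ₀ < r * √(f z) / 4 := by
    refine lt_of_pow_lt_pow_left₀ 2 (by positivity) ?_
    rw [div_pow, mul_pow, Real.sq_sqrt hz0.le]
    rw [div_mul_eq_mul_div, div_lt_iff₀ (by positivity)] at hlt
    linarith
  -- Taking `δ` strictly above `δ₀` yields a strict contradiction at the end and keeps `δ` positive
  -- even if the integral vanishes. The upper bounds serve regularity (`δ < 2`) and keep the balls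
  -- inside `B(x, r)`.
  obtain ⟨δ, hδ₀δ, hδ⟩ := exists_between (lt_min (hδ₀1.trans_lt one_lt_two) hδ₀lt)
  obtain ⟨hδ2, hδr⟩ := lt_min_iff.1 hδ
  have hδpos : 0 < δ := hδ₀pos.trans_lt hδ₀δ
  have hδz : δ / √(f z) < r / 4 := by
    rw [div_lt_iff₀ hqz]; linarith
  -- With `A = δ / 2` the displacement is below `δ / √(f z) < r / 4`, so `y₀` stays in `B(x, 3r/4)`,
  -- where the volume bound is available.
  obtain ⟨y₀, hzy, hfy, hpick⟩ := exists_edist_lt_forall_le_four_mul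
    (RiemannianGeometry.continuous_normRm (n := n) (M := M)) hz0 (half_pos hδpos)
  have hy0 : 0 < f y₀ := hz0.trans_le hfy
  set q := √(f y₀) with hq
  have hqpos : 0 < q := Real.sqrt_pos.2 hy0
  have hqle : √(f z) ≤ q := Real.sqrt_le_sqrt hfy
  set s := δ / (32 * Λ) / q with hs
  have hspos : 0 < s := by positivity
  have hsr : s < r / 4 := by
    refine lt_of_le_of_lt ?_ hδz
    rw [hs]
    gcongr
    exact div_le_self hδpos.le (by linarith)
  have hlow : ∀ w, edist y₀ w < ENNReal.ofReal s → f y₀ / 2 ≤ f w := fun w hw =>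
    hreg.le_normRm hΛ hy0 hδpos hδ2 hpick hw
  have hxy : edist y₀ x < ENNReal.ofReal (3 / 4 * r) := by
    have h1 : edist y₀ z < ENNReal.ofReal (r / 4) := by
      rw [edist_comm]
      refine hzy.trans_le (ENNReal.ofReal_le_ofReal ?_)
      rw [div_right_comm, mul_div_cancel₀ _ two_ne_zero]
      exact hδz.le
    calc edist y₀ x ≤ edist y₀ z + edist z x := edist_triangle _ _ _
      _ < ENNReal.ofReal (r / 4) + ENNReal.ofReal (1 / 2 * r) := ENNReal.add_lt_add h1 hz
      _ = ENNReal.ofReal (3 / 4 * r) := by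
        rw [← ENNReal.ofReal_add (by positivity) (by positivity)]; congr 1; ring
  have hsub : Metric.eball y₀ (ENNReal.ofReal s) ⊆ Metric.eball x (ENNReal.ofReal r) := by
    intro w hw
    calc edist w x ≤ edist w y₀ + edist y₀ x := edist_triangle _ _ _
      _ < ENNReal.ofReal s + ENNReal.ofReal (3 / 4 * r) := ENNReal.add_lt_add hw hxy
      _ ≤ ENNReal.ofReal r := by
        rw [← ENNReal.ofReal_add (by positivity) (by positivity)]
        exact ENNReal.ofReal_le_ofReal (by linarith)
  have hpt : ∀ w ∈ Metric.eball y₀ (ENNReal.ofReal s),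
      ENNReal.ofReal ((q / 2) ^ n) ≤ ENNReal.ofReal (f w ^ ((n : ℝ) / 2)) := by
    intro w hw
    apply ENNReal.ofReal_le_ofReal
    rw [Metric.mem_eball, edist_comm] at hw
    -- Weakening `q² / 2` to the perfect square `(q / 2)²` turns the power `n / 2` into the `n`-th
    -- power of `q / 2`.
    have h1 : (q / 2) ^ 2 ≤ f w := by
      refine le_trans ?_ (hlow w hw)
      rw [div_pow, Real.sq_sqrt hy0.le]
      linarith
    calc (q / 2) ^ n = ((q / 2) ^ 2) ^ ((n : ℝ) / 2) := by
          rw [← Real.rpow_natCast _ 2, ← Real.rpow_mul (by positivity), ← Real.rpow_natCast]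
          congr 1
          push_cast
          ring
      _ ≤ f w ^ ((n : ℝ) / 2) := Real.rpow_le_rpow (by positivity) h1 (by positivity)
  have hJge : ENNReal.ofReal ((q / 2) ^ n * (v * s ^ n)) ≤ J := by
    calc ENNReal.ofReal ((q / 2) ^ n * (v * s ^ n))
        = ENNReal.ofReal ((q / 2) ^ n) * ENNReal.ofReal (v * s ^ n) :=
          ENNReal.ofReal_mul (by positivity)
      _ ≤ ENNReal.ofReal ((q / 2) ^ n) * μ (Metric.eball y₀ (ENNReal.ofReal s)) := by
          gcongr
          exact hvol y₀ hxy s hspos hsr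
      _ = ∫⁻ _ in Metric.eball y₀ (ENNReal.ofReal s), ENNReal.ofReal ((q / 2) ^ n) ∂μ :=
          (MeasureTheory.setLIntegral_const _ _).symm
      _ ≤ ∫⁻ w in Metric.eball y₀ (ENNReal.ofReal s), ENNReal.ofReal (f w ^ ((n : ℝ) / 2)) ∂μ :=
          MeasureTheory.setLIntegral_mono' Metric.isOpen_eball.measurableSet hpt
      _ ≤ J := MeasureTheory.lintegral_mono_set hsub
  have hJge' : (q / 2) ^ n * (v * s ^ n) ≤ J.toReal :=
    (ENNReal.ofReal_le_iff_le_toReal hJtop).1 hJge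
  have he : (q / 2) ^ n * (v * s ^ n) = v * ε * δ ^ n := by
    have : q / 2 * s = 1 / (64 * Λ) * δ := by rw [hs]; field_simp; norm_num
    rw [hε, mul_left_comm, ← mul_pow, this, mul_pow, mul_assoc]
  have hJeq : J.toReal = v * ε * δ₀ ^ n := by
    rw [hδ₀n]; field_simp
  have hpow : δ₀ ^ n < δ ^ n := pow_lt_pow_left₀ hδ₀δ hδ₀pos hn.ne'
  rw [he, hJeq] at hJge'
  exact absurd (le_of_mul_le_mul_left hJge' (by positivity)) (not_le.2 hpow)
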